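/- **Setting.** Let $K\in\mathbb N$, let $p$ be a probability measure on a measurable space $\mathcal X$, and let $Q$ be a Markov kernel from $\mathcal X$ to $\mathbb R^K$. For each $T'\in\mathbb N$ consider data over the periods $t=-T',\dots,0,1,2,\dots$, possibly on a probability space that depends on $T'$: covariates $X_t\in\mathcal X$, actions $A_t\in\{1,\dots,K\}$, potential outcomes $(Y_t(a))_{a\le K}$, and observed rewards $Y_t=\sum_{a}\mathbb 1[A_t=a]\,Y_t(a)$. For every $t\ge -T'$, $X_t$ has law $p$ and is independent of the observed history $\{(X_s,A_s,Y_s)\}_{-T'\le s<t}$; given this history and $X_t$, the action $A_t$ and the vector $(Y_t(a))_a$ are independent, $(Y_t(a))_a$ has law $Q(X_t,\cdot)$, and $A_t$ is drawn from a behavior probability that may depend on the history and on $X_t$. Let $\mathcal S_{0:-T'}=\{(X_s,A_s,Y_s)\}_{-T'\le s\le 0}$. At all periods $t\ge1$ the behavior probability is the same function $\pi^{\mathrm b}_{0:-T'}(a\mid x,\mathcal S_{0:-T'})$ of the pre-period history. Let $\pi^{\mathrm e}_{0:-T'}(a\mid x,\mathcal S_{0:-T'})$ be an evaluation probability and $\hat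 f_{0:-T'}(a,x)=\hat f_{0:-T'}(a,x;\mathcal S_{0:-T'})$ a regression estimate, both jointly measurable functions of $x$ and the pre-period history. Write $f^*(a,x)=\mathbb E[Y_t(a)\mid X_t=x]$ and $\nu^*(a,x)=\mathrm{Var}(Y_t(a)\mid X_t=x)$ (computed from $Q$). Define $$\Gamma_t(a)=\frac{\mathbb 1[A_t=a]\,(Y_t-\hat f_{0:-T'}(a,X_t))}{\pi^{\mathrm b}_{0:-T'}(A_t\mid X_t,\mathcal S_{0:-T'})}+\hat f_{0:-T'}(a,X_t),\qquad \widehat R^{\mathrm{AIPW}'}=\frac1T\sum_{t=1}^T\sum_{a=1}^K\pi^{\mathrm e}_{0:-T'}(a\mid X_t,\mathcal S_{0:-T'})\,\Gamma_t(a),$$ $$R'=\mathbb E\Big[\sum_{a=1}^K\pi^{\mathrm e}_{0:-T'}(a\mid X_t,\mathcal S_{0:-T'})\,Y_t(a)\,\Big|\,\mathcal S_{0:-T'}\Big]\quad(\text{for any fixed } t\ge1).$$ For non-random probabilities $\pi^{\mathrm b},\pi^{\mathrm e}$ let, with $X\sim p$ and $(Y(a))_a\mid X\sim Q(X,\cdot)$,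 $R(\pi^{\mathrm e})=\mathbb E[\sum_a\pi^{\mathrm e}(a\mid X)Y(a)]$ and $$\sigma^2_{\mathrm{AIPW}}(\pi^{\mathrm b},\pi^{\mathrm e})=\mathbb E\Big[\sum_{a=1}^K\frac{\pi^{\mathrm e}(a\mid X)^2\,\nu^*(a,X)}{\pi^{\mathrm b}(a\mid X)}+\Big(\sum_{a=1}^K\pi^{\mathrm e}(a\mid X)f^*(a,X)-R(\pi^{\mathrm e})\Big)^2\Big]$$ (with $0/0=0$), and let $\sigma^{2\dagger}_{\mathrm{AIPW}}=\sigma^2_{\mathrm{AIPW}}(\pi^{\mathrm b}_{0:-T'},\pi^{\mathrm e}_{0:-T'})$ be its value at the realized probabilities; it is a function of $\mathcal S_{0:-T'}$. **Theorem.** Suppose that there are constants $C_1,C_2,C_3$, not depending on $T'$, such that * (overlap) for all $a,x$, almost surely $\pi^{\mathrm e}_{0:-T'}(a\mid x,\mathcal S_{0:-T'})\le C_1\,\pi^{\mathrm b}_{0:-T'}(a\mid x,\mathcal S_{0:-T'})$; * (bounded reward) $|Y_t|\le C_2$ almost surely for all $t\ge1$; * (i) for all $x\in\mathcal X$ and $a\in\{1,\dots,K\}$,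 $\hat f_{0:-T'}(a,x)-f^*(a,x)\to0$ in probability as $T'\to\infty$; * (ii) for all $a,x$, $|\hat f_{0:-T'}(a,x)|\le C_3$ almost surely. Then, as $T\to\infty$ and $T'\to\infty$ jointly (with no restriction on their relative rates), $\sqrt T\,(\widehat R^{\mathrm{AIPW}'}-R')$ is asymptotically $\mathcal N(0,\sigma^{2\dagger}_{\mathrm{AIPW}})$ conditionally on $\mathcal S_{0:-T'}$: for every bounded continuous $g:\mathbb R\to\mathbb R$, $$\mathbb E\big[g\big(\sqrt T(\widehat R^{\mathrm{AIPW}'}-R')\big)\,\big|\,\mathcal S_{0:-T'}\big]-\int g\,d\mathcal N\big(0,\sigma^{2\dagger}_{\mathrm{AIPW}}\big)\longrightarrow0\quad\text{in probability.}$$ In particular, for every constant $v\ge0$ such that $\sigma^{2\dagger}_{\mathrm{AIPW}}\to v$ in probability as $T'\to\infty$ (for instance, when $\sigma^{2\dagger}_{\mathrm{AIPW}}$ is equal to $v$ for all $T'$), $\sqrt T\,(\widehat R^{\mathrm{AIPW}'}-R')\to\mathcal N(0,v)$ in distribution as $T,T'\to\infty$ jointly. A normal law of variance $0$ is the point mass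 at $0$. -/

import Mathlib

open MeasureTheory ProbabilityTheory Filter Topology
open scoped BoundedContinuousFunction

noncomputable section

namespace ITOPE

/-- One logged observation: covariate, action and observed reward. -/
abbrev Obs (𝒳 : Type*) (K : ℕ) : Type _ := 𝒳 × Fin K × ℝ

/-- Trajectories `(X_s, A_s, Y_s)` over the periods `-n ≤ s < t`. In particular `Hist 𝒳 K n 1` is
the space of pre-period histories, over the periods `-n, …, -1, 0`. -/
abbrev Hist (𝒳 : Type*) (K n : ℕ) (t : ℤ) : Type _ := Finset.Ico (-(n : ℤ)) t → Obs 𝒳 K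

/-- The pre-period part of a trajectory that ends at a period `t ≥ 1`. -/
def Hist.pre {𝒳 : Type*} {K n : ℕ} {t : ℤ} (ht : 1 ≤ t) (h : Hist 𝒳 K n t) : Hist 𝒳 K n 1 :=
  Finset.restrict₂ (π := fun _ => Obs 𝒳 K) (Finset.Ico_subset_Ico le_rfl ht) h

theorem Hist.measurable_pre {𝒳 : Type*} [MeasurableSpace 𝒳] {K n : ℕ} {t : ℤ} (ht : 1 ≤ t) :
    Measurable (Hist.pre (𝒳 := 𝒳) (K := K) (n := n) ht) :=
  Finset.measurable_restrict₂ (X := fun _ => Obs 𝒳 K) (Finset.Ico_subset_Ico le_rfl ht)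

/-- The observed reward `Y = ∑ₐ 1[A = a] Y(a)`. -/
def reward {K : ℕ} (A : Fin K) (y : Fin K → ℝ) : ℝ := ∑ a, (if A = a then 1 else 0) * y a

/-- The observed trajectory over the periods `-n ≤ s < t`. -/
def hist {𝒳 Ω : Type*} {K : ℕ} (X : ℤ → Ω → 𝒳) (A : ℤ → Ω → Fin K) (Ypot : ℤ → Ω → Fin K → ℝ)
    (n : ℕ) (t : ℤ) (ω : Ω) : Hist 𝒳 K n t :=
  fun s => (X s ω, A s ω, reward (A s ω) (Ypot s ω))

/-- The data-generating process over the periods `-n, …, 0, 1, 2, …`.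
`μ` is the law of the covariate and `Q x` the law of the vector of potential outcomes given the
covariate `x`; both are invariant across periods. At period `t` the action is drawn from
`p t (· | history, X_t)`. The behavior probability may change adaptively at the periods `t ≤ 1`;
from period `1` on it stays equal to `p 1`, a function of the pre-period history. -/
structure Model (𝒳 : Type*) [MeasurableSpace 𝒳] (K : ℕ) (μ : Measure 𝒳)
    (Q : Kernel 𝒳 (Fin K → ℝ)) (n : ℕ) (Ω : Type*) [MeasurableSpace Ω] (P : Measure Ω) where
  X : ℤ → Ω → 𝒳
  A : ℤ → Ω → Fin K
  Ypot : ℤ → Ω → Fin K → ℝ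
  measurable_X : ∀ t, Measurable (X t)
  measurable_A : ∀ t, Measurable (A t)
  measurable_Ypot : ∀ t, Measurable (Ypot t)
  p : (t : ℤ) → Kernel (Hist 𝒳 K n t × 𝒳) (Fin K)
  markov_p : ∀ t, IsMarkovKernel (p t)
  p_eq : ∀ (t : ℤ) (ht : 1 ≤ t),
    p t = (p 1).comap (fun q => (Hist.pre ht q.1, q.2))
      (((Hist.measurable_pre ht).comp measurable_fst).prodMk measurable_snd)
  /-- `X_t` has law `μ` and is independent of the history before `t`; given that history and `X_t`,
  the action has law `p t`, the potential outcomes have law `Q X_t`, and the two are independent. -/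
  law : ∀ t : ℤ, -(n : ℤ) ≤ t →
    P.map (fun ω => ((hist X A Ypot n t ω, X t ω), (A t ω, Ypot t ω))) =
      ((P.map (hist X A Ypot n t)).prod μ) ⊗ₘ (p t ×ₖ Kernel.prodMkLeft (Hist 𝒳 K n t) Q)

/-- The probability of the action `a` at the covariate `x`, given the pre-period history `h`. -/
def prob {H 𝒳 : Type*} [MeasurableSpace H] [MeasurableSpace 𝒳] {K : ℕ}
    (κ : Kernel (H × 𝒳) (Fin K)) (h : H) (a : Fin K) (x : 𝒳) : ℝ := (κ (h, x)).real {a}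

section population

variable {𝒳 : Type*} [MeasurableSpace 𝒳] {K : ℕ}

/-- `f*(a, x) = E[Y(a) | x]`. -/
def fStar (Q : Kernel 𝒳 (Fin K → ℝ)) (a : Fin K) (x : 𝒳) : ℝ := ∫ y, y a ∂(Q x)

/-- `ν*(a, x) = Var(Y(a) | x)`. -/
def nuStar (Q : Kernel 𝒳 (Fin K → ℝ)) (a : Fin K) (x : 𝒳) : ℝ := Var[fun y => y a; Q x]

/-- `R(πᵉ) = E[∑ₐ πᵉ(a | X) Y(a)]` for a non-random evaluation probability `πᵉ`. -/
def value (μ : Measure 𝒳) (Q : Kernel 𝒳 (Fin K → ℝ)) (πe : Fin K → 𝒳 → ℝ) : ℝ :=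
  ∫ x, ∫ y, ∑ a, πe a x * y a ∂(Q x) ∂μ

/-- The AIPW variance of non-random behavior and evaluation probabilities `πᵇ` and `πᵉ`:
`E[∑ₐ πᵉ(a | X)² ν*(a, X) / πᵇ(a | X) + (∑ₐ πᵉ(a | X) f*(a, X) - R(πᵉ))²]`. -/
def aipwVariance (μ : Measure 𝒳) (Q : Kernel 𝒳 (Fin K → ℝ)) (πb πe : Fin K → 𝒳 → ℝ) : ℝ :=
  ∫ x, (∑ a, (πe a x) ^ 2 * nuStar Q a x / πb a x
    + (∑ a, πe a x * fStar Q a x - value μ Q πe) ^ 2) ∂μ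

/-- `Γ(a; A, X, Y, π, f) = 1[A = a] (Y - f(a, X)) / π(A | X) + f(a, X)`. -/
def aipwScore (a : Fin K) (A : Fin K) (x : 𝒳) (y : ℝ) (πb f : Fin K → 𝒳 → ℝ) : ℝ :=
  (if A = a then 1 else 0) * (y - f a x) / πb A x + f a x

end population

namespace Model

variable {𝒳 : Type*} [MeasurableSpace 𝒳] {K : ℕ} {μ : Measure 𝒳} {Q : Kernel 𝒳 (Fin K → ℝ)}
  {n : ℕ} {Ω : Type*} [MeasurableSpace Ω] {P : Measure Ω} (M : Model 𝒳 K μ Q n Ω P)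

/-- The observed reward at period `t`. -/
def Y (t : ℤ) (ω : Ω) : ℝ := reward (M.A t ω) (M.Ypot t ω)

/-- The pre-period history, over the periods `-n, …, 0`. -/
def S (ω : Ω) : Hist 𝒳 K n 1 := hist M.X M.A M.Ypot n 1 ω

/-- The σ-algebra generated by the pre-period history. -/
abbrev sigmaS : MeasurableSpace Ω := MeasurableSpace.comap M.S inferInstance

/-- The behavior probability of the evaluation periods, given the pre-period history. -/
def πb : Kernel (Hist 𝒳 K n 1 × 𝒳) (Fin K) := M.p 1

/-- The policy value conditional on the pre-period history,
`R' = E[∑ₐ πᵉ(a | X_t, S) Y_t(a) | S]`. -/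
def condValue (πe : Kernel (Hist 𝒳 K n 1 × 𝒳) (Fin K)) (t : ℤ) : Ω → ℝ :=
  P[fun ω => ∑ a, prob πe (M.S ω) a (M.X t ω) * M.Ypot t ω a | M.sigmaS]

/-- The AIPW estimator computed from the samples at the periods `1, …, T`. -/
def aipw (πe : Kernel (Hist 𝒳 K n 1 × 𝒳) (Fin K)) (fhat : Hist 𝒳 K n 1 → Fin K → 𝒳 → ℝ)
    (T : ℕ) (ω : Ω) : ℝ :=
  (1 / (T : ℝ)) * ∑ t ∈ Finset.Icc (1 : ℤ) T, ∑ a, prob πe (M.S ω) a (M.X t ω) *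
    aipwScore a (M.A t ω) (M.X t ω) (M.Y t ω) (prob M.πb (M.S ω)) (fhat (M.S ω))

/-- The AIPW variance at the realized behavior and evaluation probabilities, a function of the
pre-period history. -/
def sigmaSq (πe : Kernel (Hist 𝒳 K n 1 × 𝒳) (Fin K)) (ω : Ω) : ℝ :=
  aipwVariance μ Q (prob M.πb (M.S ω)) (prob πe (M.S ω))

/-- The scaled error `√T (R̂ - R')`; `t₀` is the period used to write `R'`. -/
def scaledError (πe : Kernel (Hist 𝒳 K n 1 × 𝒳) (Fin K))
    (fhat : Hist 𝒳 K n 1 → Fin K → 𝒳 → ℝ) (t₀ : ℤ) (T : ℕ) (ω : Ω) : ℝ :=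
  Real.sqrt T * (M.aipw πe fhat T ω - M.condValue πe t₀ ω)

end Model

/-- `Z i → 0` in probability along `l`, for random variables that may live on different
probability spaces. -/
def TendstoZeroInProb {ι : Type*} {Ω : ι → Type*} [∀ i, MeasurableSpace (Ω i)]
    (P : ∀ i, Measure (Ω i)) (Z : ∀ i, Ω i → ℝ) (l : Filter ι) : Prop :=
  ∀ ε : ℝ, 0 < ε → Tendsto (fun i => P i {ω | ε ≤ |Z i ω|}) l (𝓝 0)

end ITOPE

end

/-! Given the pre-period history `h`, the behavior probability, the evaluation probability and the
regression estimate are frozen. The scores of the evaluation periods are then independent with one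
common law `ρ h`, and the scaled error is their normalized sum after centering (`Model.map_S_sum`,
`Model.condExp_scaledError_ae_eq`). What is needed is a central limit theorem for a law that varies
with `h` and with the length of the pre-period.

Three facts about `ρ h` make this possible. It is exactly centered: the behavior probability is
known, so inverse weighting removes the bias of any regression estimate
(`Regular.integral_weightedScore`). It lives on a fixed interval `[-B, B]`, because overlap bounds
the weights. Its variance exceeds the AIPW variance by the variance, over the drawn action, of the
weighted regression error, averaged over covariates; this is at most a constant times the mean
absolute regression error (`Regular.abs_integral_sq_sub_le`).

Centered laws on a fixed interval obey a uniform central limit theorem that tolerates an error `δ`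
in the variance (`uniform_centralLimit`). Its thresholds `N` and `δ` depend only on `g`, `B` and
`ε`, which is why the rates of the two sample sizes need no relation: once `T ≥ N`, the conditional
error can reach `ε` only where the regression error is large. The probability of that event tends to
zero by pointwise consistency, boundedness and Fubini (`tendstoZeroInProb_estimateError`).

If the random variance converges to a constant, continuity of Gaussian integrals in the variance and
taking expectations remove the conditioning. -/

/-! ### A central limit theorem uniform over centered laws on a fixed interval -/

theorem norm_pow_sub_pow_le_of_norm_le_one {a b : ℂ} (ha : ‖a‖ ≤ 1) (hb : ‖b‖ ≤ 1) (n : ℕ) :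
    ‖a ^ n - b ^ n‖ ≤ n * ‖a - b‖ := by
  induction n with
  | zero => simp
  | succ n ih =>
    have h : a ^ (n + 1) - b ^ (n + 1) = a * (a ^ n - b ^ n) + (a - b) * b ^ n := by ring
    rw [h]
    calc ‖a * (a ^ n - b ^ n) + (a - b) * b ^ n‖
        ≤ ‖a‖ * ‖a ^ n - b ^ n‖ + ‖a - b‖ * ‖b‖ ^ n := by
          refine (norm_add_le _ _).trans ?_
          simp [norm_pow]
      _ ≤ 1 * (n * ‖a - b‖) + ‖a - b‖ * 1 := by
          gcongr
          exact pow_le_one₀ (norm_nonneg _) hb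
      _ = (n + 1 : ℕ) * ‖a - b‖ := by push_cast; ring

/-- Second order expansion of the characteristic function of a centered law with bounded
support. -/
theorem norm_charFun_sub_le {ρ : Measure ℝ} [IsProbabilityMeasure ρ] {B : ℝ}
    (hB : ∀ᵐ x ∂ρ, |x| ≤ B) (h0 : ∫ x, x ∂ρ = 0) (s : ℝ) (hs : B * |s| ≤ 1) :
    ‖charFun ρ s - (1 - (((∫ x, x ^ 2 ∂ρ) * s ^ 2 / 2 : ℝ) : ℂ))‖ ≤ B ^ 3 * |s| ^ 3 := by
  have i1 : Integrable (fun x : ℝ => x) ρ :=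
    .of_bound (by fun_prop) B (by simpa using hB)
  have i2 : Integrable (fun x : ℝ => x ^ 2) ρ := by
    refine .of_bound (by fun_prop) (B ^ 2) ?_
    filter_upwards [hB] with x hx
    rw [norm_pow, Real.norm_eq_abs]
    gcongr
  have i3 : Integrable (fun x : ℝ => Complex.exp (s * x * Complex.I)) ρ := by
    refine .of_bound (by fun_prop) 1 (ae_of_all _ fun x => ?_)
    rw [← Complex.ofReal_mul, Complex.norm_exp_ofReal_mul_I]
  have i1' : Integrable (fun x : ℝ => ((s * x : ℝ) : ℂ) * Complex.I) ρ :=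
    ((i1.const_mul s).ofReal).mul_const _
  have i2' : Integrable (fun x : ℝ => ((s ^ 2 / 2 * x ^ 2 : ℝ) : ℂ)) ρ :=
    (i2.const_mul _).ofReal
  -- The integrand is the exponential minus its second order Taylor polynomial; centering kills the
  -- linear term.
  have key : charFun ρ s - (1 - (((∫ x, x ^ 2 ∂ρ) * s ^ 2 / 2 : ℝ) : ℂ)) =
      ∫ x : ℝ, (Complex.exp (s * x * Complex.I) -
        (1 + ((s * x : ℝ) : ℂ) * Complex.I - ((s ^ 2 / 2 * x ^ 2 : ℝ) : ℂ))) ∂ρ := by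
    have i12 : Integrable (fun x : ℝ => 1 + ((s * x : ℝ) : ℂ) * Complex.I) ρ :=
      (integrable_const _).add i1'
    have i123 : Integrable (fun x : ℝ => 1 + ((s * x : ℝ) : ℂ) * Complex.I -
        ((s ^ 2 / 2 * x ^ 2 : ℝ) : ℂ)) ρ := i12.sub i2'
    rw [integral_sub i3 i123, integral_sub i12 i2', integral_add (integrable_const _) i1',
      integral_mul_const, integral_complex_ofReal, integral_complex_ofReal,
      integral_const_mul, integral_const_mul, h0, charFun_apply_real]
    simp
    ring
  rw [key]
  refine (norm_integral_le_of_norm_le_const (C := B ^ 3 * |s| ^ 3) ?_).trans (by simp)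
  filter_upwards [hB] with x hx
  have hz : ‖(s * x * Complex.I : ℂ)‖ = |s| * |x| := by simp
  have hz1 : ‖(s * x * Complex.I : ℂ)‖ ≤ 1 := by
    rw [hz]
    refine le_trans ?_ hs
    rw [mul_comm]
    gcongr
  have hb := Complex.exp_bound hz1 (n := 3) (by norm_num)
  have e : ∑ m ∈ Finset.range 3, (s * x * Complex.I : ℂ) ^ m / m.factorial =
      1 + ((s * x : ℝ) : ℂ) * Complex.I - ((s ^ 2 / 2 * x ^ 2 : ℝ) : ℂ) := by
    simp [Finset.sum_range_succ, Nat.factorial, mul_pow]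
    ring
  rw [e, hz] at hb
  refine hb.trans ?_
  -- The Taylor remainder constant at order 3 is `4 / (3! * 3) = 2 / 9`, which is below 1.
  calc (|s| * |x|) ^ 3 * ((Nat.succ 3 : ℕ) * ((Nat.factorial 3 : ℕ) * (3 : ℕ) : ℝ)⁻¹)
      ≤ (|s| * |x|) ^ 3 * 1 := by
        gcongr
        norm_num [Nat.factorial]
    _ ≤ (|s| * B) ^ 3 * 1 := by gcongr
    _ = B ^ 3 * |s| ^ 3 := by ring

/-- A quantitative central limit theorem for characteristic functions. -/
theorem norm_charFun_pow_sub_le {ρ : Measure ℝ} [IsProbabilityMeasure ρ] {B : ℝ}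
    (hB : ∀ᵐ x ∂ρ, |x| ≤ B) (h0 : ∫ x, x ∂ρ = 0) (v : NNReal) {T : ℕ} (hT : 0 < T) (u : ℝ)
    (h1 : B * |u| ≤ √T) (h2 : v * u ^ 2 / 2 ≤ T) :
    ‖charFun ρ (u / √T) ^ T - charFun (gaussianReal 0 v) u‖ ≤
      B ^ 3 * |u| ^ 3 / √T + |∫ x, x ^ 2 ∂ρ - v| * u ^ 2 / 2 + (v * u ^ 2 / 2) ^ 2 / T := by
  have hT' : (0 : ℝ) < T := by exact_mod_cast hT
  have hsT : 0 < √(T : ℝ) := Real.sqrt_pos.2 hT'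
  set s := u / √(T : ℝ) with hs
  have hs2 : s ^ 2 = u ^ 2 / T := by rw [hs, div_pow, Real.sq_sqrt hT'.le]
  have habs : |s| = |u| / √T := by rw [hs, abs_div, abs_of_pos hsT]
  have hBs : B * |s| ≤ 1 := by
    rw [habs, ← mul_div_assoc]
    exact (div_le_one hsT).2 h1
  -- Stability of the normal law: its characteristic function at `u` is the `T`-th power of the one
  -- at `u / √T`.
  have hg : charFun (gaussianReal 0 v) u = charFun (gaussianReal 0 v) s ^ T := by
    rw [charFun_gaussianReal, charFun_gaussianReal, ← Complex.exp_nat_mul]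
    congr 1
    have : (s : ℂ) ^ 2 = u ^ 2 / T := by exact_mod_cast hs2
    simp only [this]
    have : (T : ℂ) ≠ 0 := by exact_mod_cast hT.ne'
    field_simp
    simp
    ring
  rw [hg]
  -- Both factors lie in the unit disc, so passing to `T`-th powers costs only a factor `T`, while
  -- the errors of one factor are of order `T ^ (-3/2)`, `|V - v| / T` and `T ^ (-2)`.
  refine (norm_pow_sub_pow_le_of_norm_le_one (norm_charFun_le_one _)
    (norm_charFun_le_one _) T).trans ?_
  have hV := norm_charFun_sub_le hB h0 s hBs
  set V := ∫ x, x ^ 2 ∂ρ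
  have hx0 : (0 : ℝ) ≤ v * s ^ 2 / 2 := by positivity
  have hx1 : v * s ^ 2 / 2 ≤ 1 := by
    rw [hs2, ← mul_div_assoc, div_right_comm]
    exact (div_le_one hT').2 h2
  have hG : ‖charFun (gaussianReal 0 v) s - (1 - ((v * s ^ 2 / 2 : ℝ) : ℂ))‖ ≤
      (v * s ^ 2 / 2) ^ 2 := by
    have := Complex.norm_exp_sub_one_sub_id_le (x := ((-(v * s ^ 2 / 2) : ℝ) : ℂ))
      (by rw [Complex.norm_real, Real.norm_eq_abs, abs_neg, abs_of_nonneg hx0]; exact hx1)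
    rw [Complex.norm_real, Real.norm_eq_abs, abs_neg, abs_of_nonneg hx0] at this
    refine le_of_eq_of_le ?_ this
    rw [charFun_gaussianReal]
    congr 1
    push_cast
    simp
    ring
  have hd : ‖((V * s ^ 2 / 2 : ℝ) : ℂ) - ((v * s ^ 2 / 2 : ℝ) : ℂ)‖ = |V - v| * s ^ 2 / 2 := by
    rw [← Complex.ofReal_sub, Complex.norm_real, Real.norm_eq_abs,
      show V * s ^ 2 / 2 - v * s ^ 2 / 2 = (V - v) * (s ^ 2 / 2) by ring, abs_mul,
      abs_of_nonneg (by positivity : 0 ≤ s ^ 2 / 2)]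
    ring
  have htri : ‖charFun ρ s - charFun (gaussianReal 0 v) s‖ ≤
      B ^ 3 * |s| ^ 3 + |V - v| * s ^ 2 / 2 + (v * s ^ 2 / 2) ^ 2 := by
    have e : charFun ρ s - charFun (gaussianReal 0 v) s =
        (charFun ρ s - (1 - ((V * s ^ 2 / 2 : ℝ) : ℂ))) -
        (((V * s ^ 2 / 2 : ℝ) : ℂ) - ((v * s ^ 2 / 2 : ℝ) : ℂ)) -
        (charFun (gaussianReal 0 v) s - (1 - ((v * s ^ 2 / 2 : ℝ) : ℂ))) := by ring
    rw [e]
    refine (norm_sub_le _ _).trans (add_le_add ((norm_sub_le _ _).trans ?_) hG)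
    rw [hd]
    gcongr
  calc T * ‖charFun ρ s - charFun (gaussianReal 0 v) s‖
      ≤ T * (B ^ 3 * |s| ^ 3 + |V - v| * s ^ 2 / 2 + (v * s ^ 2 / 2) ^ 2) := by gcongr
    _ = _ := by
      rw [hs2, habs, div_pow]
      have : √(T : ℝ) ^ 3 = √T * T := by
        rw [pow_succ, Real.sq_sqrt hT'.le, mul_comm]
      rw [this]
      field_simp

/-- The centered normal law of variance `v`, as a probability measure. -/
noncomputable def centeredGaussian (v : NNReal) : ProbabilityMeasure ℝ :=
  ⟨gaussianReal 0 v, inferInstance⟩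

@[simp]
theorem coe_centeredGaussian (v : NNReal) :
    (centeredGaussian v : Measure ℝ) = gaussianReal 0 v := rfl

theorem tendsto_centeredGaussian {v : ℕ → NNReal} {v₀ : NNReal}
    (hv : Tendsto v atTop (𝓝 v₀)) :
    Tendsto (fun k => centeredGaussian (v k)) atTop (𝓝 (centeredGaussian v₀)) := by
  rw [ProbabilityMeasure.tendsto_iff_tendsto_charFun]
  intro t
  simp only [coe_centeredGaussian, charFun_gaussianReal]
  have : Continuous fun w : NNReal =>
      Complex.exp (t * (0 : ℝ) * Complex.I - (w : ℝ) * t ^ 2 / 2) := by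
    fun_prop
  exact (this.tendsto v₀).comp hv

/-- A central limit theorem that is uniform over the centered laws `ρ` supported in `[-B, B]`:
`m` is the law of the normalized sum of `T` independent copies of `ρ`. -/
theorem uniform_centralLimit (g : ℝ →ᵇ ℝ) (B : ℝ) {ε : ℝ} (hε : 0 < ε) :
    ∃ N : ℕ, ∃ δ : ℝ, 0 < δ ∧ ∀ T : ℕ, N ≤ T → ∀ ρ m : ProbabilityMeasure ℝ,
      (∀ᵐ x ∂(ρ : Measure ℝ), |x| ≤ B) → ∫ x, x ∂(ρ : Measure ℝ) = 0 →
      ∀ v : NNReal, |∫ x, x ^ 2 ∂(ρ : Measure ℝ) - v| ≤ δ →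
      (∀ u, charFun (m : Measure ℝ) u = charFun (ρ : Measure ℝ) (u / √T) ^ T) →
      |∫ z, g z ∂(m : Measure ℝ) - ∫ z, g z ∂(gaussianReal 0 v)| < ε := by
  -- Uniformity by compactness: a failure for every `N = k + 1` and `δ = 1 / (k + 1)` yields a
  -- sequence of counterexamples with `T k → ∞`, whose target variances stay in `[0, B ^ 2 + 1]`.
  by_contra! hcon
  have hk : ∀ k : ℕ, (0 : ℝ) < 1 / (k + 1) := fun k => by positivity
  choose T hT ρ m hB h0 v hv hm hbad using fun k : ℕ => hcon (k + 1) (1 / (k + 1)) (hk k)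
  have hB0 : 0 ≤ B := by
    obtain ⟨x, hx⟩ := (hB 0).exists
    exact (abs_nonneg x).trans hx
  have hVB : ∀ k, ∫ x, x ^ 2 ∂(ρ k : Measure ℝ) ≤ B ^ 2 := fun k => by
    refine (Real.le_norm_self _).trans ((norm_integral_le_of_norm_le_const (C := B ^ 2)
      (μ := (ρ k : Measure ℝ)) ?_).trans (by rw [probReal_univ, mul_one]))
    filter_upwards [hB k] with x hx
    rw [norm_pow, Real.norm_eq_abs]
    gcongr
  have hvB : ∀ k, (v k : ℝ) ≤ B ^ 2 + 1 := fun k => by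
    have h1 := (abs_le.1 (hv k)).1
    have h2 : (1 : ℝ) / (k + 1) ≤ 1 := by
      rw [div_le_one (by positivity)]
      linarith [(Nat.cast_nonneg k : (0 : ℝ) ≤ k)]
    linarith [hVB k]
  have hTt : Tendsto (fun k => (T k : ℝ)) atTop atTop := by
    refine tendsto_natCast_atTop_atTop.comp (tendsto_atTop_mono (fun k => ?_) tendsto_id)
    exact (Nat.le_succ k).trans (hT k)
  have hsq : Tendsto (fun k => √(T k : ℝ)) atTop atTop := Real.tendsto_sqrt_atTop.comp hTt
  have hdiff : ∀ u, Tendsto (fun k => charFun (m k : Measure ℝ) u -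
      charFun (gaussianReal 0 (v k)) u) atTop (𝓝 0) := by
    intro u
    have hlim : Tendsto (fun k : ℕ => B ^ 3 * |u| ^ 3 / √(T k) + (1 / ((k : ℝ) + 1)) * u ^ 2 / 2 +
        ((B ^ 2 + 1) * u ^ 2 / 2) ^ 2 / T k) atTop (𝓝 (0 + 0 * u ^ 2 / 2 + 0)) := by
      refine (Tendsto.add (hsq.const_div_atTop _) ?_).add (hTt.const_div_atTop _)
      exact (tendsto_one_div_add_atTop_nhds_zero_nat.mul_const _).div_const _
    simp only [zero_mul, zero_div, add_zero] at hlim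
    refine squeeze_zero_norm' ?_ hlim
    filter_upwards [hsq.eventually_ge_atTop (B * |u|),
      hTt.eventually_ge_atTop ((B ^ 2 + 1) * u ^ 2 / 2)] with k h1 h2
    rw [hm]
    have hvu : v k * u ^ 2 / 2 ≤ (B ^ 2 + 1) * u ^ 2 / 2 := by gcongr; exact hvB k
    refine (norm_charFun_pow_sub_le (hB k) (h0 k) (v k) ((Nat.succ_pos k).trans_le (hT k)) u h1
      (hvu.trans h2)).trans ?_
    gcongr
    · exact hv k
  -- Along a subsequence the variances converge, so by Lévy's theorem `m (φ k)` and the normal law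
  -- of variance `v (φ k)` have the same weak limit, contradicting the gap `ε`.
  obtain ⟨v₀, -, φ, hφ, hv₀⟩ := (isCompact_Icc (a := (0 : NNReal))
    (b := ⟨B ^ 2 + 1, by positivity⟩)).tendsto_subseq (x := v)
      (fun k => ⟨zero_le, hvB k⟩)
  have hG := tendsto_centeredGaussian hv₀
  have hM : Tendsto (fun k => m (φ k)) atTop (𝓝 (centeredGaussian v₀)) := by
    rw [ProbabilityMeasure.tendsto_iff_tendsto_charFun] at hG ⊢
    intro t
    have := ((hdiff t).comp hφ.tendsto_atTop).add (hG t)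
    simpa using this
  rw [ProbabilityMeasure.tendsto_iff_forall_integral_tendsto] at hG hM
  have := ((hM g).sub (hG g)).abs
  simp only [coe_centeredGaussian, sub_self, abs_zero] at this
  obtain ⟨k, hk⟩ := (this.eventually_lt_const hε).exists
  exact absurd hk (not_lt.2 (hbad (φ k)))

/-! ### Conditional law of the evaluation periods given the pre-period history -/

/-- The conditional expectation given `S` of a function of `(S, Z)`, in terms of a disintegration of
the law of `(S, Z)`. -/
theorem condExp_comap_ae_eq_integral {Ω H E : Type*} [MeasurableSpace Ω] [MeasurableSpace H]
    [MeasurableSpace E] {P : Measure Ω} [IsProbabilityMeasure P] {S : Ω → H} {Z : Ω → E}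
    (hS : Measurable S) (hZ : Measurable Z) (κ : Kernel H E) [IsMarkovKernel κ]
    (hlaw : P.map (fun ω => (S ω, Z ω)) = P.map S ⊗ₘ κ) {F : H × E → ℝ} (hF : Measurable F)
    (hint : Integrable (fun ω => F (S ω, Z ω)) P) :
    P[fun ω => F (S ω, Z ω) | MeasurableSpace.comap S inferInstance] =ᵐ[P]
      fun ω => ∫ z, F (S ω, z) ∂(κ (S ω)) := by
  have hSZ : Measurable fun ω => (S ω, Z ω) := hS.prodMk hZ
  have : IsProbabilityMeasure (P.map S) := Measure.isProbabilityMeasure_map hS.aemeasurable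
  have hI : StronglyMeasurable fun h => ∫ z, F (h, z) ∂(κ h) :=
    hF.stronglyMeasurable.integral_kernel_prod_right'
  have hintm : Integrable F (P.map S ⊗ₘ κ) := by
    rw [← hlaw, integrable_map_measure hF.aestronglyMeasurable hSZ.aemeasurable]
    exact hint
  have hint' : Integrable (fun h => ∫ z, F (h, z) ∂(κ h)) (P.map S) :=
    hintm.integral_compProd
  have hint'' : Integrable (fun ω => ∫ z, F (S ω, z) ∂(κ (S ω))) P :=
    hint'.comp_measurable hS
  symm
  refine ae_eq_condExp_of_forall_setIntegral_eq hS.comap_le hint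
    (fun _ _ _ => hint''.integrableOn) ?_ ?_
  · rintro _ ⟨B, hB, rfl⟩ -
    calc ∫ ω in S ⁻¹' B, ∫ z, F (S ω, z) ∂(κ (S ω)) ∂P
        = ∫ h in B, ∫ z, F (h, z) ∂(κ h) ∂(P.map S) :=
          (setIntegral_map hB hI.aestronglyMeasurable hS.aemeasurable).symm
      _ = ∫ p in B ×ˢ Set.univ, F p ∂(P.map S ⊗ₘ κ) := by
          rw [Measure.setIntegral_compProd hB .univ hintm.integrableOn]
          simp
      _ = ∫ ω in S ⁻¹' B, F (S ω, Z ω) ∂P := by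
          rw [← hlaw, setIntegral_map (hB.prod .univ) hF.aestronglyMeasurable hSZ.aemeasurable]
          congr 2
          ext ω
          simp
  · exact (hI.comp_measurable (comap_measurable S)).aestronglyMeasurable

namespace ITOPE

section kernels

variable {H 𝒳 : Type*} [MeasurableSpace H] [MeasurableSpace 𝒳] {K : ℕ}

/-- The law of covariate, action and potential outcomes of an evaluation period, given the
pre-period history. -/
noncomputable def drawKernel (μ : Measure 𝒳) (Q : Kernel 𝒳 (Fin K → ℝ))
    (πb : Kernel (H × 𝒳) (Fin K)) : Kernel H (𝒳 × (Fin K × (Fin K → ℝ))) :=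
  Kernel.const H μ ⊗ₖ (πb ×ₖ Kernel.prodMkLeft H Q)

instance (μ : Measure 𝒳) [IsProbabilityMeasure μ] (Q : Kernel 𝒳 (Fin K → ℝ)) [IsMarkovKernel Q]
    (πb : Kernel (H × 𝒳) (Fin K)) [IsMarkovKernel πb] : IsMarkovKernel (drawKernel μ Q πb) := by
  unfold drawKernel
  infer_instance

theorem drawKernel_apply (μ : Measure 𝒳) [IsProbabilityMeasure μ] (Q : Kernel 𝒳 (Fin K → ℝ))
    [IsMarkovKernel Q] (πb : Kernel (H × 𝒳) (Fin K)) [IsMarkovKernel πb] (h : H) :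
    drawKernel μ Q πb h =
      μ ⊗ₘ ((πb ×ₖ Kernel.prodMkLeft H Q).comap (Prod.mk h) measurable_prodMk_left) := by
  ext s hs
  rw [drawKernel, Kernel.compProd_apply hs, Measure.compProd_apply hs]
  simp

/-- The law of `w (h, z)` where `z` has law `κ h`. -/
noncomputable def pushKernel {E G : Type*} [MeasurableSpace E] [MeasurableSpace G]
    (κ : Kernel H E) (w : H × E → G) : Kernel H G := (Kernel.id ×ₖ κ).map w

instance {E G : Type*} [MeasurableSpace E] [MeasurableSpace G] (κ : Kernel H E)
    [IsFiniteKernel κ] (w : H × E → G) : IsFiniteKernel (pushKernel κ w) := by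
  unfold pushKernel
  infer_instance

theorem isMarkovKernel_pushKernel {E G : Type*} [MeasurableSpace E] [MeasurableSpace G]
    (κ : Kernel H E) [IsMarkovKernel κ] {w : H × E → G} (hw : Measurable w) :
    IsMarkovKernel (pushKernel κ w) :=
  Kernel.IsMarkovKernel.map _ hw

theorem pushKernel_apply {E G : Type*} [MeasurableSpace E] [MeasurableSpace G]
    (κ : Kernel H E) [IsSFiniteKernel κ] {w : H × E → G} (hw : Measurable w) (h : H) :
    pushKernel κ w h = (κ h).map (fun z => w (h, z)) := by
  ext s hs
  rw [pushKernel, Kernel.map_apply' _ hw _ hs, Kernel.id_prod_apply' _ _ (hw hs),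
    Measure.map_apply (by fun_prop) hs]
  rfl

/-- The law of the sum of `T` independent variables of law `ρ h`. -/
noncomputable def sumKernel (ρ : Kernel H ℝ) : ℕ → Kernel H ℝ
  | 0 => Kernel.const H (Measure.dirac 0)
  | T + 1 => (sumKernel ρ T ×ₖ ρ).map (fun p => p.1 + p.2)

instance isMarkovKernel_sumKernel (ρ : Kernel H ℝ) [IsMarkovKernel ρ] (T : ℕ) :
    IsMarkovKernel (sumKernel ρ T) := by
  induction T with
  | zero => unfold sumKernel; infer_instance
  | succ T ih => exact Kernel.IsMarkovKernel.map _ (by fun_prop)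

theorem charFun_sumKernel (ρ : Kernel H ℝ) [IsMarkovKernel ρ] (T : ℕ) (h : H) (u : ℝ) :
    charFun (sumKernel ρ T h) u = charFun (ρ h) u ^ T := by
  induction T with
  | zero => simp [sumKernel]
  | succ T ih =>
    rw [sumKernel, Kernel.map_apply _ (by fun_prop), Kernel.prod_apply, pow_succ, ← ih]
    exact charFun_conv u

end kernels

theorem measurable_reward {K : ℕ} :
    Measurable fun p : Fin K × (Fin K → ℝ) => reward p.1 p.2 := by
  unfold reward
  refine Finset.measurable_fun_sum _ fun a _ => ?_
  refine Measurable.mul (Measurable.ite ?_ measurable_const measurable_const) (by fun_prop)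
  exact measurable_fst (measurableSet_singleton a)

theorem reward_eq {K : ℕ} (a : Fin K) (y : Fin K → ℝ) : reward a y = y a := by
  simp [reward]

namespace Model

variable {𝒳 : Type*} [MeasurableSpace 𝒳] {K : ℕ} {μ : Measure 𝒳} {Q : Kernel 𝒳 (Fin K → ℝ)}
  {n : ℕ} {Ω : Type*} [MeasurableSpace Ω] {P : Measure Ω} (M : Model 𝒳 K μ Q n Ω P)

/-- Covariate, action and potential outcomes at period `t`. -/
def draw (t : ℤ) (ω : Ω) : 𝒳 × (Fin K × (Fin K → ℝ)) := (M.X t ω, M.A t ω, M.Ypot t ω)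

theorem measurable_draw (t : ℤ) : Measurable (M.draw t) :=
  (M.measurable_X t).prodMk ((M.measurable_A t).prodMk (M.measurable_Ypot t))

instance : IsMarkovKernel M.πb := M.markov_p 1

theorem measurable_hist (t : ℤ) : Measurable (hist M.X M.A M.Ypot n t) := by
  refine measurable_pi_lambda _ fun s => ?_
  exact (M.measurable_X s).prodMk ((M.measurable_A s).prodMk
    (measurable_reward.comp ((M.measurable_A s).prodMk (M.measurable_Ypot s))))

theorem measurable_S : Measurable M.S := M.measurable_hist 1

/-- The joint law of the pre-period history, a function of the history before `t ≥ 1`, and the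
draw at period `t`. -/
theorem map_pre_draw [IsProbabilityMeasure P] [IsProbabilityMeasure μ] [IsMarkovKernel Q]
    {t : ℤ} (ht : 1 ≤ t) {E : Type*} [MeasurableSpace E] {G : Hist 𝒳 K n t → E}
    (hG : Measurable G) :
    P.map (fun ω => ((M.S ω, G (hist M.X M.A M.Ypot n t ω)), M.draw t ω)) =
      (P.map (fun ω => (M.S ω, G (hist M.X M.A M.Ypot n t ω)))) ⊗ₘ
        (Kernel.prodMkRight E (drawKernel μ Q M.πb)) := by
  have := M.markov_p t
  have hh := M.measurable_hist t
  have hS := M.measurable_S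
  have hd := M.measurable_draw t
  have hX := M.measurable_X t
  have hA := M.measurable_A t
  have hY := M.measurable_Ypot t
  have hSG : Measurable fun ω => (M.S ω, G (hist M.X M.A M.Ypot n t ω)) :=
    hS.prodMk (hG.comp hh)
  have hPh : IsProbabilityMeasure (P.map (hist M.X M.A M.Ypot n t)) :=
    Measure.isProbabilityMeasure_map hh.aemeasurable
  have hPSG : IsProbabilityMeasure (P.map fun ω => (M.S ω, G (hist M.X M.A M.Ypot n t ω))) :=
    Measure.isProbabilityMeasure_map hSG.aemeasurable
  refine Measure.ext_of_lintegral _ fun f hf => ?_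
  have hpre := Hist.measurable_pre (𝒳 := 𝒳) (K := K) (n := n) ht
  let φ : (Hist 𝒳 K n t × 𝒳) × (Fin K × (Fin K → ℝ)) → ENNReal :=
    fun q => f ((Hist.pre ht q.1.1, G q.1.1), (q.1.2, q.2))
  have hφ : Measurable φ := hf.comp
    (((hpre.comp (measurable_fst.comp measurable_fst)).prodMk
      (hG.comp (measurable_fst.comp measurable_fst))).prodMk
      ((measurable_snd.comp measurable_fst).prodMk measurable_snd))
  have hlhs : ∫⁻ p, f p ∂(P.map (fun ω => ((M.S ω, G (hist M.X M.A M.Ypot n t ω)), M.draw t ω)))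
      = ∫⁻ q, φ q ∂(P.map (fun ω =>
        ((hist M.X M.A M.Ypot n t ω, M.X t ω), (M.A t ω, M.Ypot t ω)))) := by
    rw [lintegral_map hf (hSG.prodMk hd), lintegral_map hφ
      ((hh.prodMk hX).prodMk (hA.prodMk hY))]
    rfl
  have ht' : -(n : ℤ) ≤ t := by omega
  -- From period 1 on the action law sees the past only through its pre-period part; hence, given
  -- `S`, the draw is independent of `G`.
  have hp : ∀ (h : Hist 𝒳 K n t) (x : 𝒳), M.p t (h, x) = M.πb (Hist.pre ht h, x) := by
    intro h x
    rw [M.p_eq t ht]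
    rfl
  have hinner : Measurable fun s : Hist 𝒳 K n 1 × E =>
      ∫⁻ z, f (s, z) ∂(Kernel.prodMkRight E (drawKernel μ Q M.πb) s) :=
    hf.lintegral_kernel_prod_right'
  rw [hlhs, M.law t ht', Measure.lintegral_compProd hφ,
    MeasureTheory.lintegral_prod _ (hφ.lintegral_kernel_prod_right').aemeasurable,
    Measure.lintegral_compProd hf, lintegral_map hinner hSG,
    lintegral_map (by exact Measurable.lintegral_prod_right' hφ.lintegral_kernel_prod_right') hh]
  refine lintegral_congr fun ω => ?_
  rw [Kernel.prodMkRight_apply, drawKernel_apply,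
    Measure.lintegral_compProd (f := fun z => f ((M.S ω, G (hist M.X M.A M.Ypot n t ω)), z))
      (hf.comp measurable_prodMk_left)]
  refine lintegral_congr fun x => ?_
  simp only [Kernel.prod_apply, Kernel.prodMkLeft_apply, Kernel.comap_apply, hp]
  rfl

theorem map_S_draw [IsProbabilityMeasure P] [IsProbabilityMeasure μ] [IsMarkovKernel Q]
    {t : ℤ} (ht : 1 ≤ t) :
    P.map (fun ω => (M.S ω, M.draw t ω)) = P.map M.S ⊗ₘ drawKernel μ Q M.πb := by
  have hSu : Measurable fun ω => (M.S ω, ()) := M.measurable_S.prodMk measurable_const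
  have hPS : IsProbabilityMeasure (P.map M.S) :=
    Measure.isProbabilityMeasure_map M.measurable_S.aemeasurable
  have hPSu : IsProbabilityMeasure (P.map fun ω => (M.S ω, ())) :=
    Measure.isProbabilityMeasure_map hSu.aemeasurable
  have h := M.map_pre_draw ht (measurable_const (a := ()))
  refine Measure.ext_of_lintegral _ fun f hf => ?_
  have h' := congrArg (fun m : Measure _ => ∫⁻ p, f (p.1.1, p.2) ∂m) h
  have hf' : Measurable fun p : (Hist 𝒳 K n 1 × Unit) × _ => f (p.1.1, p.2) :=
    hf.comp ((measurable_fst.comp measurable_fst).prodMk measurable_snd)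
  beta_reduce at h'
  rw [lintegral_map hf' (hSu.prodMk (M.measurable_draw t)), Measure.lintegral_compProd hf',
    lintegral_map (by exact hf'.lintegral_kernel_prod_right') hSu] at h'
  rw [lintegral_map hf (M.measurable_S.prodMk (M.measurable_draw t)),
    Measure.lintegral_compProd hf, lintegral_map hf.lintegral_kernel_prod_right' M.measurable_S]
  exact h'

/-- The observed part of a draw. -/
def observe (z : 𝒳 × (Fin K × (Fin K → ℝ))) : Obs 𝒳 K := (z.1, z.2.1, reward z.2.1 z.2.2)

theorem measurable_observe :
    Measurable (observe : 𝒳 × (Fin K × (Fin K → ℝ)) → Obs 𝒳 K) :=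
  measurable_fst.prodMk ((measurable_fst.comp measurable_snd).prodMk
    (measurable_reward.comp measurable_snd))

/-- The joint law of the pre-period history and the sum of the scores `w (S, (X_t, A_t, Y_t))` over
the periods `1, …, T`. -/
theorem map_S_sum [IsProbabilityMeasure P] [IsProbabilityMeasure μ] [IsMarkovKernel Q]
    {w : Hist 𝒳 K n 1 × Obs 𝒳 K → ℝ} (hw : Measurable w) (T : ℕ) :
    P.map (fun ω => (M.S ω, ∑ t ∈ Finset.Icc (1 : ℤ) T, w (M.S ω, observe (M.draw t ω)))) =
      P.map M.S ⊗ₘ sumKernel (pushKernel (drawKernel μ Q M.πb)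
        (fun p => w (p.1, observe p.2))) T := by
  have hS := M.measurable_S
  have hPS : IsProbabilityMeasure (P.map M.S) :=
    Measure.isProbabilityMeasure_map hS.aemeasurable
  have hw' : Measurable fun p : Hist 𝒳 K n 1 × (𝒳 × (Fin K × (Fin K → ℝ))) =>
      w (p.1, observe p.2) :=
    hw.comp (measurable_fst.prodMk (measurable_observe.comp measurable_snd))
  have hterm : ∀ t, Measurable fun ω => w (M.S ω, observe (M.draw t ω)) := fun t =>
    hw.comp (hS.prodMk (measurable_observe.comp (M.measurable_draw t)))
  have hsum : ∀ T : ℕ, Measurable fun ω =>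
      ∑ t ∈ Finset.Icc (1 : ℤ) T, w (M.S ω, observe (M.draw t ω)) := fun T =>
    Finset.measurable_fun_sum _ fun t _ => hterm t
  set κ := drawKernel μ Q M.πb with hκ
  have hMk := isMarkovKernel_pushKernel κ hw'
  set ρ := pushKernel κ (fun p => w (p.1, observe p.2)) with hρ
  induction T with
  | zero =>
    refine Measure.ext_of_lintegral _ fun f hf => ?_
    rw [lintegral_map hf (hS.prodMk (hsum _)), Measure.lintegral_compProd hf,
      lintegral_map hf.lintegral_kernel_prod_right' hS]
    simp only [sumKernel, Kernel.const_apply]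
    refine lintegral_congr fun ω => ?_
    rw [lintegral_dirac' (f := fun b => f (M.S ω, b)) _ (hf.comp measurable_prodMk_left)]
    simp
  | succ T ih =>
    have ht : (1 : ℤ) ≤ T + 1 := by omega
    -- The partial sum over `1, …, T` is a function of the history strictly before `T + 1`, so given
    -- `S` the next draw is independent of it.
    let G : Hist 𝒳 K n (T + 1) → ℝ := fun h =>
      ∑ t : Finset.Icc (1 : ℤ) T, w (Hist.pre ht h, h ⟨t, by
        have := Finset.mem_Icc.1 t.2
        exact Finset.mem_Ico.2 ⟨by omega, by omega⟩⟩)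
    have hG : Measurable G := Finset.measurable_fun_sum _ fun t _ =>
      hw.comp ((Hist.measurable_pre ht).prodMk (measurable_pi_apply _))
    have hGs : ∀ ω, G (hist M.X M.A M.Ypot n (T + 1) ω) =
        ∑ t ∈ Finset.Icc (1 : ℤ) T, w (M.S ω, observe (M.draw t ω)) := fun ω =>
      Finset.sum_coe_sort (Finset.Icc (1 : ℤ) T) (fun t => w (M.S ω, observe (M.draw t ω)))
    have hlaw := M.map_pre_draw ht hG
    simp only [hGs] at hlaw
    rw [ih] at hlaw
    have hsucc : ∀ ω, ∑ t ∈ Finset.Icc (1 : ℤ) (T + 1 : ℕ), w (M.S ω, observe (M.draw t ω)) =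
        ∑ t ∈ Finset.Icc (1 : ℤ) T, w (M.S ω, observe (M.draw t ω)) +
          w (M.S ω, observe (M.draw (T + 1) ω)) := by
      intro ω
      have : Finset.Icc (1 : ℤ) (T + 1 : ℕ) = insert ((T : ℤ) + 1) (Finset.Icc (1 : ℤ) T) := by
        ext t
        simp only [Finset.mem_Icc, Finset.mem_insert]
        omega
      rw [this, Finset.sum_insert (by simp), add_comm]
    simp only [hsucc]
    refine Measure.ext_of_lintegral _ fun f hf => ?_
    let ψ : (Hist 𝒳 K n 1 × ℝ) × (𝒳 × (Fin K × (Fin K → ℝ))) → ENNReal := fun p =>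
      f (p.1.1, p.1.2 + w (p.1.1, observe p.2))
    have hψ : Measurable ψ := hf.comp ((measurable_fst.comp measurable_fst).prodMk
      ((measurable_snd.comp measurable_fst).add
        (hw'.comp ((measurable_fst.comp measurable_fst).prodMk measurable_snd))))
    have h' := congrArg (fun m : Measure _ => ∫⁻ p, ψ p ∂m) hlaw
    beta_reduce at h'
    rw [lintegral_map hψ ((hS.prodMk (hsum T)).prodMk (M.measurable_draw _)),
      Measure.lintegral_compProd hψ,
      Measure.lintegral_compProd hψ.lintegral_kernel_prod_right'] at h'
    have hm : Measurable fun ω =>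
        (M.S ω, ∑ t ∈ Finset.Icc (1 : ℤ) T, w (M.S ω, observe (M.draw t ω)) +
          w (M.S ω, observe (M.draw (T + 1) ω))) := hS.prodMk ((hsum T).add (hterm (T + 1)))
    rw [lintegral_map hf hm, Measure.lintegral_compProd hf]
    refine h'.trans (lintegral_congr fun h => ?_)
    have hfh : Measurable fun p : ℝ × ℝ => f (h, p.1 + p.2) :=
      hf.comp (measurable_const.prodMk (measurable_fst.add measurable_snd))
    rw [sumKernel, Kernel.map_apply _ (by fun_prop),
      lintegral_map (f := fun b => f (h, b)) (hf.comp measurable_prodMk_left) (by fun_prop),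
      Kernel.lintegral_prod _ _ _ hfh]
    refine lintegral_congr fun s => ?_
    have hwh : Measurable fun z => w (h, observe z) := hw'.comp measurable_prodMk_left
    rw [hρ, pushKernel_apply κ hw']
    exact (lintegral_map (f := fun r => f (h, s + r)) (hfh.comp measurable_prodMk_left) hwh).symm

end Model

end ITOPE

/-! ### Moments of the score at a fixed history and covariate -/

namespace ITOPE

theorem ae_prod_of_forall_fin {K : ℕ} {F : Type*} [MeasurableSpace F] {p : Measure (Fin K)}
    {q : Measure F} [SFinite p] [SFinite q] {r : Fin K × F → Prop} (hr : MeasurableSet {z | r z})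
    (h : ∀ a, p {a} ≠ 0 → ∀ᵐ y ∂q, r (a, y)) : ∀ᵐ z ∂(p.prod q), r z := by
  rw [Measure.ae_prod_iff_ae_ae hr]
  exact ae_iff_of_countable.2 h

theorem integral_fin_prod {K : ℕ} {F : Type*} [MeasurableSpace F] {p : Measure (Fin K)}
    {q : Measure F} [IsFiniteMeasure p] [SFinite q] {f : Fin K × F → ℝ}
    (hf : Integrable f (p.prod q)) :
    ∫ z, f z ∂(p.prod q) = ∑ a, p.real {a} * ∫ y, f (a, y) ∂q := by
  rw [integral_prod _ hf, integral_fintype .of_finite]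
  simp

/-- Bias-variance decomposition: the cross term vanishes because `Y` minus its mean is centered. -/
theorem integral_sq_mul_sub_add {F : Type*} [MeasurableSpace F] {q : Measure F}
    [IsProbabilityMeasure q] {Y : F → ℝ} (hY : MemLp Y 2 q) (c k : ℝ) :
    ∫ y, (c * (Y y - ∫ z, Y z ∂q) + k) ^ 2 ∂q = c ^ 2 * Var[Y; q] + k ^ 2 := by
  set m := ∫ z, Y z ∂q with hm
  have i1 : Integrable Y q := hY.integrable (by norm_num)
  have i2 : Integrable (fun y => (Y y - m) ^ 2) q := (hY.sub (memLp_const m)).integrable_sq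
  have i1' : Integrable (fun y => Y y - m) q := i1.sub (integrable_const _)
  have e : ∀ y, (c * (Y y - m) + k) ^ 2 =
      c ^ 2 * (Y y - m) ^ 2 + 2 * c * k * (Y y - m) + k ^ 2 := fun y => by ring
  have i3 : Integrable (fun y => c ^ 2 * (Y y - m) ^ 2 + 2 * c * k * (Y y - m)) q :=
    (i2.const_mul _).add (i1'.const_mul _)
  simp only [e]
  rw [integral_add i3 (integrable_const _), integral_add (i2.const_mul _) (i1'.const_mul _), integral_const_mul, integral_const_mul,
    integral_sub i1 (integrable_const _), variance_eq_integral hY.aemeasurable, ← hm]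
  simp

/-- The bounds that hold at almost every covariate for almost every pre-period history: `p` is the
law of the action, `q` the law of the potential outcomes, `e` the evaluation probability and `f`
the regression estimate. -/
structure Regular {K : ℕ} (p : Measure (Fin K)) (q : Measure (Fin K → ℝ)) (e f : Fin K → ℝ)
    (C₁ C₂ C₃ : ℝ) : Prop where
  nonneg : ∀ a, 0 ≤ e a
  sum_eq_one : ∑ a, e a = 1
  overlap : ∀ a, e a ≤ C₁ * p.real {a}
  reward_le : ∀ a, p {a} ≠ 0 → ∀ᵐ y ∂q, |y a| ≤ C₂
  estimate_le : ∀ a, |f a| ≤ C₃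
  mean_le : ∀ a, |∫ y, y a ∂q| ≤ C₃

/-- The weighted score at the action `a` and the potential outcomes `y`. -/
noncomputable def weightedScore {K : ℕ} (p : Measure (Fin K)) (e f : Fin K → ℝ) (z : Fin K × (Fin K → ℝ)) : ℝ :=
  e z.1 * ((z.2 z.1 - f z.1) / p.real {z.1}) + ∑ b, e b * f b

theorem measurable_weightedScore {K : ℕ} (p : Measure (Fin K)) (e f : Fin K → ℝ) :
    Measurable (weightedScore p e f) := by
  refine measurable_from_prod_countable_right fun a => ?_
  unfold weightedScore
  dsimp only
  fun_prop

namespace Regular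

variable {K : ℕ} {p : Measure (Fin K)} {q : Measure (Fin K → ℝ)} {e f : Fin K → ℝ}
  {C₁ C₂ C₃ : ℝ} (h : Regular p q e f C₁ C₂ C₃)

include h

theorem abs_sum_mul_le {d : Fin K → ℝ} {C : ℝ} (hd : ∀ a, |d a| ≤ C) :
    |∑ a, e a * d a| ≤ C :=
  calc |∑ a, e a * d a| ≤ ∑ a, |e a * d a| := Finset.abs_sum_le_sum_abs _ _
    _ ≤ ∑ a, e a * C := by
      refine Finset.sum_le_sum fun a _ => ?_
      rw [abs_mul, abs_of_nonneg (h.nonneg a)]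
      exact mul_le_mul_of_nonneg_left (hd a) (h.nonneg a)
    _ = C := by rw [← Finset.sum_mul, h.sum_eq_one, one_mul]

theorem le_one (a : Fin K) : e a ≤ 1 :=
  h.sum_eq_one ▸ Finset.single_le_sum (fun b _ => h.nonneg b) (Finset.mem_univ a)

/-- This consequence of overlap makes the convention `x / 0 = 0` harmless: actions that are never
drawn carry no evaluation weight. -/
theorem eq_zero {a : Fin K} (ha : p.real {a} = 0) : e a = 0 :=
  le_antisymm (by simpa [ha] using h.overlap a) (h.nonneg a)

theorem mul_div_cancel_real (a : Fin K) : p.real {a} * (e a / p.real {a}) = e a := by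
  by_cases ha : p.real {a} = 0
  · simp [ha, h.eq_zero ha]
  · field_simp

theorem div_le (hC₁ : 0 ≤ C₁) (a : Fin K) : e a / p.real {a} ≤ C₁ :=
  div_le_of_le_mul₀ measureReal_nonneg hC₁ (h.overlap a)

theorem div_nonneg' (a : Fin K) : 0 ≤ e a / p.real {a} :=
  div_nonneg (h.nonneg a) measureReal_nonneg

/-- Bounded observed rewards say nothing about potential outcomes of actions that are never drawn,
but these have weight zero. -/
theorem ae_abs_sum_mul_le : ∀ᵐ y ∂q, |∑ a, e a * y a| ≤ C₂ := by
  have hy : ∀ᵐ y ∂q, ∀ a, p {a} ≠ 0 → |y a| ≤ C₂ := by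
    refine ae_all_iff.2 fun a => ?_
    by_cases ha : p {a} = 0
    · simp [ha]
    · filter_upwards [h.reward_le a ha] with y hy _ using hy
  filter_upwards [hy] with y hy
  calc |∑ a, e a * y a| ≤ ∑ a, |e a * y a| := Finset.abs_sum_le_sum_abs _ _
    _ ≤ ∑ a, e a * C₂ := by
      refine Finset.sum_le_sum fun a _ => ?_
      by_cases ha : p {a} = 0
      · simp [h.eq_zero (a := a) (by simp [measureReal_def, ha])]
      · rw [abs_mul, abs_of_nonneg (h.nonneg a)]
        exact mul_le_mul_of_nonneg_left (hy a ha) (h.nonneg a)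
    _ = C₂ := by rw [← Finset.sum_mul, h.sum_eq_one, one_mul]

variable [IsProbabilityMeasure q]

/-- The weight is at most `C₁` and the residual at most `C₂ + C₃`; the averaged regression estimate
adds `C₃`. -/
theorem ae_abs_weightedScore_le (hC₁ : 0 ≤ C₁) :
    ∀ᵐ z ∂(p.prod q), |weightedScore p e f z| ≤ C₁ * (C₂ + C₃) + C₃ := by
  refine ae_prod_of_forall_fin (measurableSet_le (measurable_weightedScore p e f).abs
    measurable_const) fun a ha => ?_
  filter_upwards [h.reward_le a ha] with y hy
  refine (abs_add_le _ _).trans (add_le_add ?_ (h.abs_sum_mul_le h.estimate_le))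
  dsimp only
  rw [mul_div_left_comm, mul_comm, abs_mul, abs_of_nonneg (h.div_nonneg' a)]
  refine mul_le_mul (h.div_le hC₁ a) ?_ (abs_nonneg _) hC₁
  exact (abs_sub _ _).trans (add_le_add hy (h.estimate_le a))

theorem memLp_two {a : Fin K} (ha : p.real {a} ≠ 0) : MemLp (fun y => y a) 2 q :=
  MemLp.of_bound (measurable_pi_apply a).aestronglyMeasurable C₂
    (h.reward_le a fun h0 => ha (by simp [measureReal_def, h0]))

theorem integral_sum_mul : ∫ y, ∑ a, e a * y a ∂q = ∑ a, e a * ∫ y, y a ∂q := by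
  rw [integral_finsetSum]
  · simp only [integral_const_mul]
  · intro a _
    by_cases ha : p.real {a} = 0
    · simp [h.eq_zero ha]
    · exact ((h.memLp_two ha).integrable (by norm_num)).const_mul _

variable [IsProbabilityMeasure p]

theorem integrable_weightedScore (hC₁ : 0 ≤ C₁) :
    Integrable (weightedScore p e f) (p.prod q) :=
  .of_bound (measurable_weightedScore p e f).aestronglyMeasurable _ (h.ae_abs_weightedScore_le hC₁)

/-- Inverse weighting turns the correction into the `e`-average of mean minus `f`, which cancels the
regression term whatever `f` is. -/
theorem integral_weightedScore (hC₁ : 0 ≤ C₁) :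
    ∫ z, weightedScore p e f z ∂(p.prod q) = ∑ a, e a * ∫ y, y a ∂q := by
  rw [integral_fin_prod (h.integrable_weightedScore hC₁)]
  have key : ∀ a, p.real {a} * ∫ y, weightedScore p e f (a, y) ∂q =
      e a * (∫ y, y a ∂q) - e a * f a + p.real {a} * ∑ b, e b * f b := by
    intro a
    by_cases ha : p.real {a} = 0
    · simp [ha, h.eq_zero ha]
    have i : Integrable (fun y : Fin K → ℝ => y a) q := (h.memLp_two ha).integrable (by norm_num)
    simp only [weightedScore]
    have i' : Integrable (fun y : Fin K → ℝ => e a * ((y a - f a) / p.real {a})) q :=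
      ((i.sub (integrable_const _)).div_const _).const_mul _
    rw [integral_add i' (integrable_const _), integral_const_mul, integral_div,
      integral_sub i (integrable_const _)]
    simp
    field_simp
  rw [Finset.sum_congr rfl fun a _ => key a, Finset.sum_add_distrib, Finset.sum_sub_distrib,
    ← Finset.sum_mul]
  simp

/-- With `c = e / p` and `d` the mean minus `f`, the difference is exactly the variance of `c a * d
a` when `a` has law `p`. Dropping the squared mean `D ^ 2` and using `e * c ≤ C₁`, `|d| ≤ 2 * C₃`
leaves a bound linear in `|d|`. -/
theorem abs_integral_sq_sub_le (hC₁ : 0 ≤ C₁) (R : ℝ) :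
    |∫ z, (weightedScore p e f z - R) ^ 2 ∂(p.prod q) -
      (∑ a, e a ^ 2 * Var[fun y => y a; q] / p.real {a} + (∑ a, e a * ∫ y, y a ∂q - R) ^ 2)| ≤
      C₁ * (2 * C₃) * ∑ a, |f a - ∫ y, y a ∂q| := by
  have hC₃ : ∀ a : Fin K, 0 ≤ C₃ := fun a => (abs_nonneg _).trans (h.estimate_le a)
  have hsum : ∑ a, p.real {a} = 1 := by simp
  set m : Fin K → ℝ := fun a => ∫ y, y a ∂q with hm
  set c : Fin K → ℝ := fun a => e a / p.real {a} with hc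
  set d : Fin K → ℝ := fun a => m a - f a with hd
  set D := ∑ a, e a * d a with hD
  set r := ∑ a, e a * m a - R with hr
  have hpc : ∀ a, p.real {a} * c a = e a := h.mul_div_cancel_real
  have hint : Integrable (fun z => (weightedScore p e f z - R) ^ 2) (p.prod q) := by
    refine .of_bound (((measurable_weightedScore p e f).sub_const R).pow_const 2).aestronglyMeasurable
      ((C₁ * (C₂ + C₃) + C₃ + |R|) ^ 2) ?_
    filter_upwards [h.ae_abs_weightedScore_le hC₁] with z hz
    rw [norm_pow, Real.norm_eq_abs]
    gcongr
    exact (abs_sub _ _).trans (by gcongr)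
  have hf : ∑ a, e a * f a = ∑ a, e a * m a - D := by
    rw [hD, ← Finset.sum_sub_distrib]
    exact Finset.sum_congr rfl fun a _ => by simp only [hd]; ring
  have key : ∀ a, p.real {a} * ∫ y, (weightedScore p e f (a, y) - R) ^ 2 ∂q =
      e a ^ 2 * Var[fun y => y a; q] / p.real {a} + p.real {a} * (c a * d a - D + r) ^ 2 := by
    intro a
    by_cases ha : p.real {a} = 0
    · simp [ha]
    -- For a fixed action the score is centered noise scaled by `c a` plus a constant, the form
    -- required by `integral_sq_mul_sub_add`.
    have hs : ∀ y : Fin K → ℝ, (weightedScore p e f (a, y) - R) ^ 2 =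
        (c a * (y a - ∫ y, y a ∂q) + (c a * d a - D + r)) ^ 2 := by
      intro y
      simp only [weightedScore, hf, hc, hd, hr, hm]
      ring
    simp only [hs]
    rw [integral_sq_mul_sub_add (h.memLp_two ha)]
    simp only [hc]
    field_simp
  have hDc : ∑ a, p.real {a} * (c a * d a) = D :=
    Finset.sum_congr rfl fun a _ => by rw [← mul_assoc, hpc]
  have expand : ∀ r : ℝ, ∑ a, p.real {a} * (c a * d a - D + r) ^ 2 =
      ∑ a, p.real {a} * (c a * d a) ^ 2 - D ^ 2 + r ^ 2 := by
    intro r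
    have e1 : ∀ a, p.real {a} * (c a * d a - D + r) ^ 2 =
        p.real {a} * (c a * d a) ^ 2 + 2 * (r - D) * (p.real {a} * (c a * d a)) +
          (r - D) ^ 2 * p.real {a} := fun a => by ring
    rw [Finset.sum_congr rfl fun a _ => e1 a, Finset.sum_add_distrib, Finset.sum_add_distrib,
      ← Finset.mul_sum, ← Finset.mul_sum, hsum, hDc]
    ring
  rw [integral_fin_prod hint, Finset.sum_congr rfl fun a _ => key a, Finset.sum_add_distrib,
    expand]
  have hpos : 0 ≤ ∑ a, p.real {a} * (c a * d a) ^ 2 - D ^ 2 := by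
    -- At `r = 0` the expansion writes the difference as a sum of nonnegative terms.
    have := expand 0
    rw [zero_pow two_ne_zero, add_zero] at this
    rw [← this]
    exact Finset.sum_nonneg fun a _ => mul_nonneg measureReal_nonneg (sq_nonneg _)
  have hle : ∑ a, p.real {a} * (c a * d a) ^ 2 ≤ C₁ * (2 * C₃) * ∑ a, |f a - m a| := by
    rw [Finset.mul_sum]
    refine Finset.sum_le_sum fun a _ => ?_
    have e1 : p.real {a} * (c a * d a) ^ 2 = e a * c a * (|d a| * |d a|) := by
      rw [abs_mul_abs_self, ← hpc a]
      ring
    have h1 : e a * c a ≤ C₁ := by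
      calc e a * c a ≤ 1 * C₁ :=
            mul_le_mul (h.le_one a) (h.div_le hC₁ a) (h.div_nonneg' a) zero_le_one
        _ = C₁ := one_mul _
    have h2 : |d a| ≤ 2 * C₃ := by
      have := (abs_sub (m a) (f a)).trans (add_le_add (h.mean_le a) (h.estimate_le a))
      simpa [hd, two_mul] using this
    rw [e1, abs_sub_comm (f a) (m a)]
    calc e a * c a * (|d a| * |d a|) ≤ C₁ * (2 * C₃ * |d a|) := by
          refine mul_le_mul h1 (by gcongr) (by positivity) hC₁
      _ = C₁ * (2 * C₃) * |m a - f a| := by ring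
  rw [show ∀ A X r : ℝ, A + (X + r) - (A + r) = X from fun A X r => by ring, abs_of_nonneg hpos]
  linarith [sq_nonneg D]

end Regular

end ITOPE

/-! ### Moments of the score at a fixed history, averaged over covariates -/

namespace ITOPE

variable {H 𝒳 : Type*} [MeasurableSpace H] [MeasurableSpace 𝒳] {K : ℕ}

theorem measurable_prob (κ : Kernel (H × 𝒳) (Fin K)) (a : Fin K) :
    Measurable fun p : H × 𝒳 => prob κ p.1 a p.2 :=
  (Kernel.measurable_coe κ (measurableSet_singleton a)).ennreal_toReal

theorem measurable_fStar (Q : Kernel 𝒳 (Fin K → ℝ)) [IsMarkovKernel Q] (a : Fin K) :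
    Measurable (fStar Q a) := by
  have : StronglyMeasurable fun p : 𝒳 × (Fin K → ℝ) => p.2 a :=
    ((measurable_pi_apply a).comp measurable_snd).stronglyMeasurable
  exact this.integral_kernel_prod_right'.measurable

theorem measurable_nuStar (Q : Kernel 𝒳 (Fin K → ℝ)) [IsMarkovKernel Q] (a : Fin K) :
    Measurable (nuStar Q a) := by
  have h1 : StronglyMeasurable fun p : 𝒳 × (Fin K → ℝ) => (p.2 a - fStar Q a p.1) ^ 2 :=
    ((((measurable_pi_apply a).comp measurable_snd).sub
      ((measurable_fStar Q a).comp measurable_fst)).pow_const 2).stronglyMeasurable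
  have h2 : nuStar Q a = fun x => ∫ y, (y a - fStar Q a x) ^ 2 ∂(Q x) :=
    funext fun x => variance_eq_integral (measurable_pi_apply a).aemeasurable
  rw [h2]
  exact h1.integral_kernel_prod_right'.measurable

theorem measurable_value (μ : Measure 𝒳) [IsProbabilityMeasure μ] (Q : Kernel 𝒳 (Fin K → ℝ))
    [IsMarkovKernel Q] (πe : Kernel (H × 𝒳) (Fin K)) :
    Measurable fun h : H => value μ Q (prob πe h) := by
  have h1 : StronglyMeasurable fun p : (H × 𝒳) × (Fin K → ℝ) =>
      ∑ a, prob πe p.1.1 a p.1.2 * p.2 a :=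
    (Finset.measurable_fun_sum _ fun a _ => ((measurable_prob πe a).comp measurable_fst).mul
      ((measurable_pi_apply a).comp measurable_snd)).stronglyMeasurable
  have h2 : StronglyMeasurable fun p : H × 𝒳 =>
      ∫ y, ∑ a, prob πe p.1 a p.2 * y a ∂(Kernel.prodMkLeft H Q p) :=
    h1.integral_kernel_prod_right'
  exact h2.integral_prod_right'.measurable

/-- The centered score of an observation, given the pre-period history. -/
noncomputable def centeredScore (μ : Measure 𝒳) (Q : Kernel 𝒳 (Fin K → ℝ))
    (πb πe : Kernel (H × 𝒳) (Fin K)) (f : H → Fin K → 𝒳 → ℝ) (p : H × Obs 𝒳 K) : ℝ :=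
  ∑ b, prob πe p.1 b p.2.1 * aipwScore b p.2.2.1 p.2.1 p.2.2.2 (prob πb p.1) (f p.1) -
    value μ Q (prob πe p.1)

theorem measurable_centeredScore (μ : Measure 𝒳) [IsProbabilityMeasure μ]
    (Q : Kernel 𝒳 (Fin K → ℝ)) [IsMarkovKernel Q] (πb πe : Kernel (H × 𝒳) (Fin K))
    {f : H → Fin K → 𝒳 → ℝ} (hf : ∀ a, Measurable fun q : H × 𝒳 => f q.1 a q.2) :
    Measurable (centeredScore μ Q πb πe f) := by
  have hx : Measurable fun p : H × Obs 𝒳 K => (p.1, p.2.1) :=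
    measurable_fst.prodMk (measurable_fst.comp measurable_snd)
  have ha : Measurable fun p : H × Obs 𝒳 K => p.2.2.1 := by fun_prop
  have hind : ∀ b, MeasurableSet {p : H × Obs 𝒳 K | p.2.2.1 = b} := fun b =>
    ha (measurableSet_singleton b)
  have hπ : Measurable fun p : H × Obs 𝒳 K => prob πb p.1 p.2.2.1 p.2.1 := by
    have e : (fun p : H × Obs 𝒳 K => prob πb p.1 p.2.2.1 p.2.1) =
        fun p => ∑ b, if p.2.2.1 = b then prob πb p.1 b p.2.1 else 0 := by
      ext p
      simp
    rw [e]
    exact Finset.measurable_fun_sum _ fun b _ =>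
      Measurable.ite (hind b) ((measurable_prob πb b).comp hx) measurable_const
  refine (Finset.measurable_fun_sum _ fun b _ => ((measurable_prob πe b).comp hx).mul ?_).sub
    ((measurable_value μ Q πe).comp measurable_fst)
  unfold aipwScore
  have hfb : Measurable fun p : H × Obs 𝒳 K => f p.1 b p.2.1 := (hf b).comp hx
  exact (((Measurable.ite (hind b) measurable_const measurable_const).mul
    ((by fun_prop : Measurable fun p : H × Obs 𝒳 K => p.2.2.2).sub hfb)).div hπ).add hfb

/-- The pre-period history `h` is regular if the bounds hold at almost every covariate. -/
def RegularAt (μ : Measure 𝒳) (Q : Kernel 𝒳 (Fin K → ℝ)) (πb πe : Kernel (H × 𝒳) (Fin K))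
    (f : H → Fin K → 𝒳 → ℝ) (C₁ C₂ C₃ : ℝ) (h : H) : Prop :=
  ∀ᵐ x ∂μ, Regular (πb (h, x)) (Q x) (fun a => prob πe h a x) (fun a => f h a x) C₁ C₂ C₃

/-- The indicator keeps only the drawn action in the correction, and there the observed reward is
the potential outcome of that action. -/
theorem centeredScore_observe (μ : Measure 𝒳) (Q : Kernel 𝒳 (Fin K → ℝ))
    (πb πe : Kernel (H × 𝒳) (Fin K)) (f : H → Fin K → 𝒳 → ℝ) (h : H) (x : 𝒳)
    (z : Fin K × (Fin K → ℝ)) :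
    centeredScore μ Q πb πe f (h, Model.observe (x, z)) =
      weightedScore (πb (h, x)) (fun a => prob πe h a x) (fun a => f h a x) z -
        value μ Q (prob πe h) := by
  have e : ∀ b, prob πe h b x * aipwScore b z.1 x (z.2 z.1) (prob πb h) (f h) =
      (if z.1 = b then prob πe h b x * ((z.2 z.1 - f h b x) / prob πb h z.1 x) else 0) +
        prob πe h b x * f h b x := by
    intro b
    simp only [aipwScore]
    split_ifs <;> ring
  simp only [centeredScore, Model.observe, reward_eq, e, weightedScore, Finset.sum_add_distrib]
  simp [prob]

section drawKernel

variable {μ : Measure 𝒳} [IsProbabilityMeasure μ] {Q : Kernel 𝒳 (Fin K → ℝ)} [IsMarkovKernel Q]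
  {πb : Kernel (H × 𝒳) (Fin K)} [IsMarkovKernel πb] {h : H}

theorem ae_drawKernel_iff {r : 𝒳 × (Fin K × (Fin K → ℝ)) → Prop} (hr : MeasurableSet {z | r z}) :
    (∀ᵐ z ∂(drawKernel μ Q πb h), r z) ↔
      ∀ᵐ x ∂μ, ∀ᵐ z ∂((πb (h, x)).prod (Q x)), r (x, z) := by
  rw [drawKernel_apply, Measure.ae_compProd_iff hr]
  simp only [Kernel.comap_apply, Kernel.prod_apply, Kernel.prodMkLeft_apply]

theorem integral_drawKernel {F : 𝒳 × (Fin K × (Fin K → ℝ)) → ℝ}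
    (hF : Integrable F (drawKernel μ Q πb h)) :
    ∫ z, F z ∂(drawKernel μ Q πb h) = ∫ x, ∫ z, F (x, z) ∂((πb (h, x)).prod (Q x)) ∂μ := by
  rw [drawKernel_apply] at hF ⊢
  rw [Measure.integral_compProd hF]
  simp only [Kernel.comap_apply, Kernel.prod_apply, Kernel.prodMkLeft_apply]

theorem stronglyMeasurable_integral_prod {F : 𝒳 × (Fin K × (Fin K → ℝ)) → ℝ}
    (hF : Measurable F) :
    StronglyMeasurable fun x => ∫ z, F (x, z) ∂((πb (h, x)).prod (Q x)) := by
  have := hF.stronglyMeasurable.integral_kernel_prod_right' (κ :=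
    (πb ×ₖ Kernel.prodMkLeft H Q).comap (Prod.mk h) measurable_prodMk_left)
  simpa only [Kernel.comap_apply, Kernel.prod_apply, Kernel.prodMkLeft_apply] using this

end drawKernel

theorem measurable_expectedReward (πe : Kernel (H × 𝒳) (Fin K)) (h : H) :
    Measurable fun z : 𝒳 × (Fin K × (Fin K → ℝ)) => ∑ a, prob πe h a z.1 * z.2.2 a :=
  Finset.measurable_fun_sum _ fun a _ =>
    ((measurable_prob πe a).comp (measurable_const.prodMk measurable_fst)).mul (by fun_prop)

namespace RegularAt

variable {μ : Measure 𝒳} {Q : Kernel 𝒳 (Fin K → ℝ)} {πb πe : Kernel (H × 𝒳) (Fin K)}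
  {f : H → Fin K → 𝒳 → ℝ} {C₁ C₂ C₃ : ℝ} {h : H} (hr : RegularAt μ Q πb πe f C₁ C₂ C₃ h)

include hr

theorem ae_abs_mean_le : ∀ᵐ x ∂μ, |∑ a, prob πe h a x * fStar Q a x| ≤ C₃ := by
  filter_upwards [hr] with x hx
  exact hx.abs_sum_mul_le hx.mean_le

variable [IsMarkovKernel Q]

theorem value_eq : value μ Q (prob πe h) = ∫ x, ∑ a, prob πe h a x * fStar Q a x ∂μ := by
  refine integral_congr_ae ?_
  filter_upwards [hr] with x hx
  exact hx.integral_sum_mul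

variable [IsProbabilityMeasure μ]

theorem abs_value_le : |value μ Q (prob πe h)| ≤ C₃ := by
  rw [hr.value_eq, ← Real.norm_eq_abs]
  exact (norm_integral_le_of_norm_le_const hr.ae_abs_mean_le).trans (by simp)

theorem integrable_mean : Integrable (fun x => ∑ a, prob πe h a x * fStar Q a x) μ := by
  refine .of_bound (Measurable.aestronglyMeasurable ?_) C₃ hr.ae_abs_mean_le
  exact Finset.measurable_fun_sum _ fun a _ =>
    ((measurable_prob πe a).comp measurable_prodMk_left).mul (measurable_fStar Q a)

theorem integrable_estimate_error (hf : ∀ a, Measurable fun q : H × 𝒳 => f q.1 a q.2)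
    (a : Fin K) :
    Integrable (fun x => |f h a x - fStar Q a x|) μ := by
  have hm : Measurable fun x => f h a x - fStar Q a x :=
    ((hf a).comp measurable_prodMk_left).sub (measurable_fStar Q a)
  refine .of_bound hm.abs.aestronglyMeasurable (C₃ + C₃) ?_
  filter_upwards [hr] with x hx
  rw [Real.norm_eq_abs, abs_abs]
  exact (abs_sub _ _).trans (add_le_add (hx.estimate_le a) (hx.mean_le a))

variable [IsMarkovKernel πb]

theorem ae_abs_reward_drawKernel_le :
    ∀ᵐ z ∂(drawKernel μ Q πb h), |∑ a, prob πe h a z.1 * z.2.2 a| ≤ C₂ := by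
  have hm := measurable_expectedReward (K := K) πe h
  rw [ae_drawKernel_iff (measurableSet_le hm.abs measurable_const)]
  filter_upwards [hr] with x hx
  exact Measure.quasiMeasurePreserving_snd.ae hx.ae_abs_sum_mul_le

theorem integral_reward_drawKernel :
    ∫ z, ∑ a, prob πe h a z.1 * z.2.2 a ∂(drawKernel μ Q πb h) = value μ Q (prob πe h) := by
  rw [integral_drawKernel (.of_bound (measurable_expectedReward πe h).aestronglyMeasurable C₂
    hr.ae_abs_reward_drawKernel_le)]
  refine integral_congr_ae (ae_of_all _ fun x => ?_)
  dsimp only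
  rw [integral_fun_snd (μ := πb (h, x)) (ν := Q x) fun y => ∑ a, prob πe h a x * y a]
  simp

variable (hf : ∀ a, Measurable fun q : H × 𝒳 => f q.1 a q.2) (hC₁ : 0 ≤ C₁)

include hf hC₁

theorem ae_abs_centeredScore_le :
    ∀ᵐ z ∂(drawKernel μ Q πb h), |centeredScore μ Q πb πe f (h, Model.observe z)| ≤
      C₁ * (C₂ + C₃) + C₃ + C₃ := by
  have hw := measurable_centeredScore μ Q πb πe hf
  have hm : Measurable fun z => centeredScore μ Q πb πe f (h, Model.observe z) :=
    hw.comp (measurable_const.prodMk Model.measurable_observe)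
  rw [ae_drawKernel_iff (measurableSet_le hm.abs measurable_const)]
  filter_upwards [hr] with x hx
  filter_upwards [hx.ae_abs_weightedScore_le hC₁] with z hz
  rw [centeredScore_observe]
  exact (abs_sub _ _).trans (add_le_add hz hr.abs_value_le)

theorem integral_centeredScore :
    ∫ z, centeredScore μ Q πb πe f (h, Model.observe z) ∂(drawKernel μ Q πb h) = 0 := by
  have hw := measurable_centeredScore μ Q πb πe hf
  have hm : Measurable fun z => centeredScore μ Q πb πe f (h, Model.observe z) :=
    hw.comp (measurable_const.prodMk Model.measurable_observe)
  rw [integral_drawKernel (.of_bound hm.aestronglyMeasurable _ (hr.ae_abs_centeredScore_le hf hC₁))]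
  have key : (fun x => ∫ z, centeredScore μ Q πb πe f (h, Model.observe (x, z))
      ∂((πb (h, x)).prod (Q x))) =ᵐ[μ]
      fun x => ∑ a, prob πe h a x * fStar Q a x - value μ Q (prob πe h) := by
    filter_upwards [hr] with x hx
    simp only [centeredScore_observe]
    rw [integral_sub (hx.integrable_weightedScore hC₁) (integrable_const _),
      hx.integral_weightedScore hC₁]
    simp [fStar]
  rw [integral_congr_ae key, integral_sub hr.integrable_mean (integrable_const _), hr.value_eq]
  simp

theorem abs_integral_sq_centeredScore_sub_le :
    |∫ z, centeredScore μ Q πb πe f (h, Model.observe z) ^ 2 ∂(drawKernel μ Q πb h) -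
      aipwVariance μ Q (prob πb h) (prob πe h)| ≤
      C₁ * (2 * C₃) * ∑ a, ∫ x, |f h a x - fStar Q a x| ∂μ := by
  have hw := measurable_centeredScore μ Q πb πe hf
  have hm : Measurable fun z => centeredScore μ Q πb πe f (h, Model.observe z) :=
    hw.comp (measurable_const.prodMk Model.measurable_observe)
  have hb := hr.ae_abs_centeredScore_le hf hC₁
  set B := C₁ * (C₂ + C₃) + C₃ + C₃
  have hi : Integrable (fun z => centeredScore μ Q πb πe f (h, Model.observe z) ^ 2)
      (drawKernel μ Q πb h) := by
    refine .of_bound (hm.pow_const 2).aestronglyMeasurable (B ^ 2) ?_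
    filter_upwards [hb] with z hz
    rw [norm_pow, Real.norm_eq_abs]
    gcongr
  set E : 𝒳 → ℝ := fun x => ∫ z, centeredScore μ Q πb πe f (h, Model.observe (x, z)) ^ 2
    ∂((πb (h, x)).prod (Q x)) with hE
  set I : 𝒳 → ℝ := fun x => ∑ a, (prob πe h a x) ^ 2 * nuStar Q a x / prob πb h a x
    + (∑ a, prob πe h a x * fStar Q a x - value μ Q (prob πe h)) ^ 2 with hI
  have hEI : ∀ᵐ x ∂μ, ‖E x - I x‖ ≤ C₁ * (2 * C₃) * ∑ a, |f h a x - fStar Q a x| := by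
    filter_upwards [hr] with x hx
    have := hx.abs_integral_sq_sub_le hC₁ (value μ Q (prob πe h))
    simp only [hE, hI, centeredScore_observe]
    exact this
  have hEi : Integrable E μ := by
    refine .of_bound (stronglyMeasurable_integral_prod (hm.pow_const 2)).aestronglyMeasurable
      (B ^ 2) ?_
    rw [ae_drawKernel_iff (measurableSet_le hm.abs measurable_const)] at hb
    filter_upwards [hb] with x hx
    refine (norm_integral_le_of_norm_le_const (C := B ^ 2) ?_).trans (by simp)
    filter_upwards [hx] with z hz
    rw [norm_pow, Real.norm_eq_abs]
    gcongr
  have hprob : ∀ (κ : Kernel (H × 𝒳) (Fin K)) (a : Fin K), Measurable fun x => prob κ h a x :=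
    fun κ a => (measurable_prob κ a).comp measurable_prodMk_left
  have hIm : Measurable I := by
    have h1 := hprob πe
    have h2 := hprob πb
    have h3 := measurable_nuStar Q
    have h4 := measurable_fStar Q
    fun_prop
  have hsum : Integrable (fun x => C₁ * (2 * C₃) * ∑ a, |f h a x - fStar Q a x|) μ :=
    (integrable_finsetSum _ fun a _ => hr.integrable_estimate_error hf a).const_mul _
  have hd : Integrable (fun x => E x - I x) μ :=
    hsum.mono' (hEi.aestronglyMeasurable.sub hIm.aestronglyMeasurable) hEI
  -- Integrability of the variance integrand is not assumed; it is recovered from the bounded `E`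
  -- and the dominated difference `E - I`.
  have hIi : Integrable I μ := by
    have := hEi.sub hd
    refine this.congr (ae_of_all _ fun x => ?_)
    simp
  rw [integral_drawKernel hi, aipwVariance]
  change |∫ x, E x ∂μ - ∫ x, I x ∂μ| ≤ _
  rw [← integral_sub hEi hIi, ← Real.norm_eq_abs,
    ← integral_finsetSum _ fun a _ => hr.integrable_estimate_error hf a, ← integral_const_mul]
  exact norm_integral_le_of_norm_le hsum hEI

end RegularAt

end ITOPE

/-! ### Convergence in probability, and the conditional law of the scaled error -/

namespace ITOPE

section convergence

variable {ι : Type*} {Ω : ι → Type*} [∀ i, MeasurableSpace (Ω i)] {P : ∀ i, Measure (Ω i)}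
  [∀ i, IsProbabilityMeasure (P i)] {Z : ∀ i, Ω i → ℝ} {l : Filter ι}

/-- Splitting at `ε / 2` bounds the integral by `ε / 2` plus `C` times the probability of exceeding
`ε / 2`. -/
theorem TendstoZeroInProb.tendsto_integral_abs (h : TendstoZeroInProb P Z l)
    (hZ : ∀ i, Measurable (Z i)) {C : ℝ} (hC : ∀ i, ∀ᵐ ω ∂(P i), |Z i ω| ≤ C) :
    Tendsto (fun i => ∫ ω, |Z i ω| ∂(P i)) l (𝓝 0) := by
  rw [tendsto_order]
  refine ⟨fun a ha => Eventually.of_forall fun i =>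
    ha.trans_le (integral_nonneg fun _ => abs_nonneg _), fun ε hε => ?_⟩
  have h1 := (ENNReal.tendsto_toReal ENNReal.zero_ne_top).comp (h (ε / 2) (half_pos hε))
  have h2 : Tendsto (fun i => C * (P i).real {ω | ε / 2 ≤ |Z i ω|}) l (𝓝 (C * 0)) :=
    Tendsto.const_mul C h1
  rw [mul_zero] at h2
  filter_upwards [h2.eventually_lt_const (half_pos hε)] with i hi
  have hs : MeasurableSet {ω | ε / 2 ≤ |Z i ω|} := measurableSet_le measurable_const (hZ i).abs
  have hint : Integrable (fun ω => ε / 2 + {ω | ε / 2 ≤ |Z i ω|}.indicator (fun _ => C) ω) (P i) :=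
    (integrable_const _).add ((integrable_const C).indicator hs)
  calc ∫ ω, |Z i ω| ∂(P i)
      ≤ ∫ ω, (ε / 2 + {ω | ε / 2 ≤ |Z i ω|}.indicator (fun _ => C) ω) ∂(P i) := by
        refine integral_mono_ae (.of_bound (hZ i).abs.aestronglyMeasurable C ?_) hint ?_
        · simpa using hC i
        · filter_upwards [hC i] with ω hω
          by_cases hω' : ε / 2 ≤ |Z i ω|
          · simp only [Set.indicator, Set.mem_ofPred_eq, hω', if_true]
            linarith
          · simp only [Set.indicator, Set.mem_ofPred_eq, hω', if_false]
            linarith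
    _ = ε / 2 + C * (P i).real {ω | ε / 2 ≤ |Z i ω|} := by
        rw [integral_add (integrable_const _) ((integrable_const C).indicator hs),
          integral_indicator_const C hs]
        simp [mul_comm]
    _ < ε := by linarith

theorem tendstoZeroInProb_of_tendsto_integral_abs (hZ : ∀ i, Integrable (Z i) (P i))
    (h : Tendsto (fun i => ∫ ω, |Z i ω| ∂(P i)) l (𝓝 0)) : TendstoZeroInProb P Z l := by
  intro ε hε
  have h1 : Tendsto (fun i => (P i).real {ω | ε ≤ |Z i ω|}) l (𝓝 0) := by
    have h2 := h.div_const ε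
    rw [zero_div] at h2
    refine squeeze_zero (fun _ => measureReal_nonneg) (fun i => ?_) h2
    rw [le_div_iff₀' hε]
    exact mul_meas_ge_le_integral_of_nonneg (ae_of_all _ fun _ => abs_nonneg _) (hZ i).abs ε
  have h3 := ENNReal.tendsto_ofReal h1
  simpa [measureReal_def, ENNReal.ofReal_toReal] using h3

end convergence

theorem continuous_integral_gaussianReal (g : ℝ →ᵇ ℝ) :
    Continuous fun v : NNReal => ∫ z, g z ∂(gaussianReal 0 v) := by
  refine continuous_iff_continuousAt.2 fun v₀ => tendsto_of_seq_tendsto fun v hv => ?_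
  exact (ProbabilityMeasure.tendsto_iff_forall_integral_tendsto.1
    (tendsto_centeredGaussian hv)) g

namespace Model

variable {𝒳 : Type*} [MeasurableSpace 𝒳] {K : ℕ} {μ : Measure 𝒳} {Q : Kernel 𝒳 (Fin K → ℝ)}
  {n : ℕ} {Ω : Type*} [MeasurableSpace Ω] {P : Measure Ω} (M : Model 𝒳 K μ Q n Ω P)

/-- The assumptions hold for each covariate off a null set depending on it; Fubini exchanges the
order, so that one typical history is good at almost every covariate. -/
theorem ae_ae_of_forall_ae [SFinite P] [SFinite μ] {r : Hist 𝒳 K n 1 × 𝒳 → Prop}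
    (hr : MeasurableSet {p | r p}) (h : ∀ x, ∀ᵐ ω ∂P, r (M.S ω, x)) :
    ∀ᵐ s ∂(P.map M.S), ∀ᵐ x ∂μ, r (s, x) := by
  have h1 : ∀ᵐ x ∂μ, ∀ᵐ s ∂(P.map M.S), r (s, x) := ae_of_all _ fun x =>
    (ae_map_iff M.measurable_S.aemeasurable (measurable_prodMk_right hr)).2 (h x)
  exact (Measure.ae_ae_comm (p := fun x s => r (s, x)) (measurable_swap hr)).1 h1

/-- Almost every pre-period history is regular. -/
theorem ae_regularAt [IsProbabilityMeasure P] [IsProbabilityMeasure μ] [IsMarkovKernel Q]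
    (πe : Kernel (Hist 𝒳 K n 1 × 𝒳) (Fin K)) [IsMarkovKernel πe]
    {fhat : Hist 𝒳 K n 1 → Fin K → 𝒳 → ℝ}
    (hfhat : ∀ a, Measurable (fun q : Hist 𝒳 K n 1 × 𝒳 => fhat q.1 a q.2)) {C₁ C₂ C₃ : ℝ}
    (overlap : ∀ a x, ∀ᵐ ω ∂P, prob πe (M.S ω) a x ≤ C₁ * prob M.πb (M.S ω) a x)
    (bounded_reward : ∀ᵐ ω ∂P, |M.Y 1 ω| ≤ C₂)
    (bounded_fhat : ∀ a x, ∀ᵐ ω ∂P, |fhat (M.S ω) a x| ≤ C₃)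
    (bounded_fStar : ∀ a x, |fStar Q a x| ≤ C₃) :
    ∀ᵐ h ∂(P.map M.S), RegularAt μ Q M.πb πe fhat |C₁| C₂ C₃ h := by
  have h1 : ∀ᵐ h ∂(P.map M.S), ∀ a, ∀ᵐ x ∂μ, prob πe h a x ≤ C₁ * prob M.πb h a x :=
    ae_all_iff.2 fun a => M.ae_ae_of_forall_ae
      (r := fun p => prob πe p.1 a p.2 ≤ C₁ * prob M.πb p.1 a p.2)
      (measurableSet_le (measurable_prob πe a) ((measurable_prob M.πb a).const_mul C₁)) (overlap a)
  have h2 : ∀ᵐ h ∂(P.map M.S), ∀ a, ∀ᵐ x ∂μ, |fhat h a x| ≤ C₃ :=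
    ae_all_iff.2 fun a => M.ae_ae_of_forall_ae (r := fun p => |fhat p.1 a p.2| ≤ C₃)
      (measurableSet_le (hfhat a).abs measurable_const) (bounded_fhat a)
  have h3 : ∀ᵐ h ∂(P.map M.S), ∀ᵐ x ∂μ, ∀ a, M.πb (h, x) {a} ≠ 0 →
      ∀ᵐ y ∂(Q x), |y a| ≤ C₂ := by
    have hm : MeasurableSet {z : 𝒳 × (Fin K × (Fin K → ℝ)) | |reward z.2.1 z.2.2| ≤ C₂} :=
      measurableSet_le (measurable_reward.comp measurable_snd).abs measurable_const
    have hPS : IsProbabilityMeasure (P.map M.S) :=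
      Measure.isProbabilityMeasure_map M.measurable_S.aemeasurable
    -- Period 1 suffices, since given `S` all evaluation periods share the law `drawKernel`.
    have hlaw : ∀ᵐ p ∂(P.map M.S ⊗ₘ drawKernel μ Q M.πb), |reward p.2.2.1 p.2.2.2| ≤ C₂ := by
      rw [← M.map_S_draw le_rfl]
      exact (ae_map_iff (M.measurable_S.prodMk (M.measurable_draw 1)).aemeasurable
        (measurable_snd hm)).2 bounded_reward
    filter_upwards [Measure.ae_ae_of_ae_compProd hlaw] with h hh
    filter_upwards [(ae_drawKernel_iff hm).1 hh] with x hx a ha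
    simpa only [reward_eq] using ae_iff_of_countable.1 (Measure.ae_ae_of_ae_prod hx) a ha
  filter_upwards [h1, h2, h3] with h h1 h2 h3
  filter_upwards [ae_all_iff.2 h1, ae_all_iff.2 h2, h3] with x h1 h2 h3
  refine ⟨fun a => measureReal_nonneg, ?_, fun a => (h1 a).trans ?_, h3, h2,
    fun a => bounded_fStar a x⟩
  · simp [prob]
  · exact mul_le_mul_of_nonneg_right (le_abs_self _) measureReal_nonneg

section estimator

variable [IsProbabilityMeasure μ] [IsMarkovKernel Q] (πe : Kernel (Hist 𝒳 K n 1 × 𝒳) (Fin K)) {fhat : Hist 𝒳 K n 1 → Fin K → 𝒳 → ℝ}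
  {C₁ C₂ C₃ : ℝ}

theorem measurable_scaledError (hfhat : ∀ a, Measurable
    (fun q : Hist 𝒳 K n 1 × 𝒳 => fhat q.1 a q.2)) (t₀ : ℤ) (T : ℕ) :
    Measurable (M.scaledError πe fhat t₀ T) := by
  have hw := measurable_centeredScore μ Q M.πb πe hfhat
  have e : M.aipw πe fhat T = fun ω => (1 / (T : ℝ)) * ∑ t ∈ Finset.Icc (1 : ℤ) T,
      (centeredScore μ Q M.πb πe fhat (M.S ω, observe (M.draw t ω)) +
        value μ Q (prob πe (M.S ω))) := by
    ext ω
    simp [aipw, centeredScore, observe, draw, Y]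
  have hA : Measurable (M.aipw πe fhat T) := by
    rw [e]
    refine Measurable.const_mul (Finset.measurable_fun_sum _ fun t _ => ?_) _
    exact (hw.comp (M.measurable_S.prodMk (measurable_observe.comp (M.measurable_draw t)))).add
      ((measurable_value μ Q πe).comp M.measurable_S)
  have hV : Measurable (M.condValue πe t₀) :=
    (stronglyMeasurable_condExp.mono M.measurable_S.comap_le).measurable
  exact (hA.sub hV).const_mul _

variable [IsProbabilityMeasure P]

/-- The conditional law of the draw is the same at all `t₀ ≥ 1`, so the period used to write `R'` is
immaterial. -/
theorem condValue_ae_eq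
    (hreg : ∀ᵐ h ∂(P.map M.S), RegularAt μ Q M.πb πe fhat C₁ C₂ C₃ h) {t₀ : ℤ} (ht₀ : 1 ≤ t₀) :
    M.condValue πe t₀ =ᵐ[P] fun ω => value μ Q (prob πe (M.S ω)) := by
  have hPS : IsProbabilityMeasure (P.map M.S) :=
    Measure.isProbabilityMeasure_map M.measurable_S.aemeasurable
  have hSd := M.measurable_S.prodMk (M.measurable_draw t₀)
  let F : Hist 𝒳 K n 1 × (𝒳 × (Fin K × (Fin K → ℝ))) → ℝ := fun p =>
    ∑ a, prob πe p.1 a p.2.1 * p.2.2.2 a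
  have hF : Measurable F := Finset.measurable_fun_sum _ fun a _ =>
    ((measurable_prob πe a).comp
      (measurable_fst.prodMk (measurable_fst.comp measurable_snd))).mul
      ((measurable_pi_apply a).comp
        (measurable_snd.comp (measurable_snd.comp measurable_snd)))
  have hb : ∀ᵐ p ∂(P.map M.S ⊗ₘ drawKernel μ Q M.πb), |F p| ≤ C₂ := by
    rw [Measure.ae_compProd_iff (measurableSet_le hF.abs measurable_const)]
    filter_upwards [hreg] with h hr using hr.ae_abs_reward_drawKernel_le
  rw [← M.map_S_draw ht₀] at hb
  have hint : Integrable (fun ω => F (M.S ω, M.draw t₀ ω)) P :=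
    .of_bound (hF.comp hSd).aestronglyMeasurable C₂ (ae_of_ae_map hSd.aemeasurable hb)
  refine (condExp_comap_ae_eq_integral M.measurable_S (M.measurable_draw t₀)
    (drawKernel μ Q M.πb) (M.map_S_draw ht₀) hF hint).trans ?_
  filter_upwards [ae_of_ae_map M.measurable_S.aemeasurable hreg] with ω hr
  exact hr.integral_reward_drawKernel

/-- The scaled error is a normalized sum of centered scores. -/
theorem scaledError_ae_eq
    (hreg : ∀ᵐ h ∂(P.map M.S), RegularAt μ Q M.πb πe fhat C₁ C₂ C₃ h) {t₀ : ℤ} (ht₀ : 1 ≤ t₀)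
    {T : ℕ} (hT : 0 < T) :
    M.scaledError πe fhat t₀ T =ᵐ[P] fun ω => (∑ t ∈ Finset.Icc (1 : ℤ) T,
      centeredScore μ Q M.πb πe fhat (M.S ω, observe (M.draw t ω))) / √T := by
  filter_upwards [M.condValue_ae_eq πe hreg ht₀] with ω hω
  have hT' : (0 : ℝ) < T := by exact_mod_cast hT
  have e : ∀ t, centeredScore μ Q M.πb πe fhat (M.S ω, observe (M.draw t ω)) =
      (∑ a, prob πe (M.S ω) a (M.X t ω) *
        aipwScore a (M.A t ω) (M.X t ω) (M.Y t ω) (prob M.πb (M.S ω)) (fhat (M.S ω))) -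
      value μ Q (prob πe (M.S ω)) := fun t => rfl
  rw [scaledError, hω, aipw]
  simp only [e, Finset.sum_sub_distrib]
  have h2 : √(T : ℝ) * √T = T := Real.mul_self_sqrt hT'.le
  have h3 : √(T : ℝ) ≠ 0 := (Real.sqrt_pos.2 hT').ne'
  rw [eq_div_iff h3, mul_right_comm, h2]
  simp
  field_simp

/-- The conditional expectation of a function of the scaled error is an integral against the law of
a sum of independent centered scores. -/
theorem condExp_scaledError_ae_eq (hfhat : ∀ a, Measurable
    (fun q : Hist 𝒳 K n 1 × 𝒳 => fhat q.1 a q.2))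
    (hreg : ∀ᵐ h ∂(P.map M.S), RegularAt μ Q M.πb πe fhat C₁ C₂ C₃ h) {t₀ : ℤ} (ht₀ : 1 ≤ t₀)
    {T : ℕ} (hT : 0 < T) (g : ℝ →ᵇ ℝ) :
    P[fun ω => g (M.scaledError πe fhat t₀ T ω) | M.sigmaS] =ᵐ[P] fun ω =>
      ∫ s, g (s / √T) ∂(sumKernel (pushKernel (drawKernel μ Q M.πb)
        (fun p => centeredScore μ Q M.πb πe fhat (p.1, observe p.2))) T (M.S ω)) := by
  have hw := measurable_centeredScore μ Q M.πb πe hfhat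
  have hw' : Measurable fun p : Hist 𝒳 K n 1 × (𝒳 × (Fin K × (Fin K → ℝ))) =>
      centeredScore μ Q M.πb πe fhat (p.1, observe p.2) :=
    hw.comp (measurable_fst.prodMk (measurable_observe.comp measurable_snd))
  have := isMarkovKernel_pushKernel (drawKernel μ Q M.πb) hw'
  have hsum : Measurable fun ω => ∑ t ∈ Finset.Icc (1 : ℤ) T,
      centeredScore μ Q M.πb πe fhat (M.S ω, observe (M.draw t ω)) :=
    Finset.measurable_fun_sum _ fun t _ =>
      hw.comp (M.measurable_S.prodMk (measurable_observe.comp (M.measurable_draw t)))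
  have hgT : Measurable fun s : ℝ => g (s / √T) :=
    g.continuous.measurable.comp (measurable_id.div_const _)
  have hc : (fun ω => g (M.scaledError πe fhat t₀ T ω)) =ᵐ[P] fun ω =>
      g ((∑ t ∈ Finset.Icc (1 : ℤ) T,
        centeredScore μ Q M.πb πe fhat (M.S ω, observe (M.draw t ω))) / √T) := by
    filter_upwards [M.scaledError_ae_eq πe hreg ht₀ hT] with ω hω
    rw [hω]
  refine (condExp_congr_ae hc).trans ?_
  exact condExp_comap_ae_eq_integral M.measurable_S hsum _ (M.map_S_sum hw T)
    (F := fun p => g (p.2 / √T)) (hgT.comp measurable_snd)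
    (.of_bound (hgT.comp hsum).aestronglyMeasurable ‖g‖ (ae_of_all _ fun ω => g.norm_coe_le_norm _))

end estimator

end Model

end ITOPE

/-! ### Joint limit, regression error and removal of the conditioning -/

namespace ITOPE

variable {𝒳 : Type*} [MeasurableSpace 𝒳] {K : ℕ}

/-- The mean absolute error of a regression estimate, summed over the actions. -/
noncomputable def estimateError (μ : Measure 𝒳) (Q : Kernel 𝒳 (Fin K → ℝ)) (f : Fin K → 𝒳 → ℝ) :
    ℝ := ∑ a, ∫ x, |f a x - fStar Q a x| ∂μ

theorem aipwVariance_nonneg (μ : Measure 𝒳) (Q : Kernel 𝒳 (Fin K → ℝ)) {H : Type*}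
    [MeasurableSpace H] (πb : Kernel (H × 𝒳) (Fin K)) (h : H) (πe : Fin K → 𝒳 → ℝ) :
    0 ≤ aipwVariance μ Q (prob πb h) πe :=
  integral_nonneg fun _ => add_nonneg (Finset.sum_nonneg fun _ _ => div_nonneg
    (mul_nonneg (sq_nonneg _) (variance_nonneg _ _)) measureReal_nonneg) (sq_nonneg _)

/-- Applies the uniform limit theorem at one regular history. The regression error enters only
through the variance tolerance `δ`; centering and support are free of it. -/
theorem RegularAt.abs_integral_sumKernel_sub_lt {H : Type*} [MeasurableSpace H] {μ : Measure 𝒳}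
    [IsProbabilityMeasure μ] {Q : Kernel 𝒳 (Fin K → ℝ)} [IsMarkovKernel Q]
    {πb πe : Kernel (H × 𝒳) (Fin K)} [IsMarkovKernel πb] {f : H → Fin K → 𝒳 → ℝ}
    {C₁ C₂ C₃ : ℝ} {h : H} (hr : RegularAt μ Q πb πe f C₁ C₂ C₃ h)
    (hf : ∀ a, Measurable fun q : H × 𝒳 => f q.1 a q.2) (hC₁ : 0 ≤ C₁)
    {T : ℕ} (g : ℝ →ᵇ ℝ) {δ ε : ℝ}
    (huniform : ∀ ρ m : ProbabilityMeasure ℝ,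
      (∀ᵐ x ∂(ρ : Measure ℝ), |x| ≤ C₁ * (C₂ + C₃) + C₃ + C₃) →
      ∫ x, x ∂(ρ : Measure ℝ) = 0 →
      ∀ v : NNReal, |∫ x, x ^ 2 ∂(ρ : Measure ℝ) - v| ≤ δ →
      (∀ u, charFun (m : Measure ℝ) u = charFun (ρ : Measure ℝ) (u / √T) ^ T) →
      |∫ z, g z ∂(m : Measure ℝ) - ∫ z, g z ∂(gaussianReal 0 v)| < ε)
    (hδ : C₁ * (2 * C₃) * estimateError μ Q (f h) ≤ δ) :
    |∫ s, g (s / √T) ∂(sumKernel (pushKernel (drawKernel μ Q πb)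
        (fun p => centeredScore μ Q πb πe f (p.1, Model.observe p.2))) T h) -
      ∫ z, g z ∂(gaussianReal 0 (aipwVariance μ Q (prob πb h) (prob πe h)).toNNReal)| < ε := by
  have hw := measurable_centeredScore μ Q πb πe hf
  have hw' : Measurable fun p : H × (𝒳 × (Fin K × (Fin K → ℝ))) =>
      centeredScore μ Q πb πe f (p.1, Model.observe p.2) :=
    hw.comp (measurable_fst.prodMk (Model.measurable_observe.comp measurable_snd))
  have hMk := isMarkovKernel_pushKernel (drawKernel μ Q πb) hw'
  have hm : Measurable fun z => centeredScore μ Q πb πe f (h, Model.observe z) :=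
    hw.comp (measurable_const.prodMk Model.measurable_observe)
  have hρh := pushKernel_apply (drawKernel μ Q πb) hw' h
  dsimp only at hρh
  set ρ := pushKernel (drawKernel μ Q πb)
    (fun p => centeredScore μ Q πb πe f (p.1, Model.observe p.2))
  have hdiv : Measurable fun s : ℝ => s / √T := measurable_id.div_const _
  have hprob : IsProbabilityMeasure ((sumKernel ρ T h).map fun s => s / √T) :=
    Measure.isProbabilityMeasure_map hdiv.aemeasurable
  have key := huniform ⟨ρ h, inferInstance⟩ ⟨(sumKernel ρ T h).map fun s => s / √T, hprob⟩
  simp only [ProbabilityMeasure.coe_mk] at key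
  rw [integral_map hdiv.aemeasurable g.continuous.measurable.aestronglyMeasurable] at key
  refine key ?_ ?_ _ ?_ ?_
  · rw [hρh, ae_map_iff hm.aemeasurable
      (measurableSet_le (by fun_prop : Measurable fun x : ℝ => |x|) measurable_const)]
    exact hr.ae_abs_centeredScore_le hf hC₁
  · rw [hρh, integral_map hm.aemeasurable (by fun_prop)]
    exact hr.integral_centeredScore hf hC₁
  · rw [hρh, integral_map hm.aemeasurable (by fun_prop),
      Real.coe_toNNReal _ (aipwVariance_nonneg μ Q πb _ _)]
    exact (hr.abs_integral_sq_centeredScore_sub_le hf hC₁).trans hδ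
  · intro u
    simp only [div_eq_inv_mul]
    rw [charFun_map_mul, charFun_sumKernel]

section sequence

variable {μ : Measure 𝒳} {Q : Kernel 𝒳 (Fin K → ℝ)} {Ω : ℕ → Type*} [∀ n, MeasurableSpace (Ω n)] {P : ∀ n, Measure (Ω n)}
  [∀ n, IsProbabilityMeasure (P n)] (M : ∀ n, Model 𝒳 K μ Q n (Ω n) (P n))
  {fhat : ∀ n, Hist 𝒳 K n 1 → Fin K → 𝒳 → ℝ} {C₃ : ℝ}

/-- Estimates bounded by `C₃` would otherwise stay a fixed distance away from `fStar`. This controls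
the means even for actions whose rewards are never observed. -/
theorem abs_fStar_le_of_consistent
    (consistent : ∀ a x, TendstoZeroInProb P
      (fun n ω => fhat n ((M n).S ω) a x - fStar Q a x) atTop)
    (bounded_fhat : ∀ n a x, ∀ᵐ ω ∂(P n), |fhat n ((M n).S ω) a x| ≤ C₃) (a : Fin K) (x : 𝒳) :
    |fStar Q a x| ≤ C₃ := by
  by_contra! hlt
  have h := consistent a x _ (sub_pos.2 hlt)
  have h1 : ∀ n, P n {ω | |fStar Q a x| - C₃ ≤ |fhat n ((M n).S ω) a x - fStar Q a x|} = 1 := by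
    intro n
    rw [← measure_univ (μ := P n)]
    refine measure_congr (eventuallyEq_univ.2 ?_)
    filter_upwards [bounded_fhat n a x] with ω hω
    have := abs_sub_abs_le_abs_sub (fStar Q a x) (fhat n ((M n).S ω) a x)
    rw [abs_sub_comm] at this
    change _ ≤ _
    linarith
  simp only [h1] at h
  exact one_ne_zero (tendsto_nhds_unique tendsto_const_nhds h)

/-- At each fixed covariate, boundedness upgrades consistency to convergence in mean; dominated
convergence integrates this over covariates, and Fubini turns it into convergence of the expected
error. -/
theorem tendstoZeroInProb_estimateError [IsProbabilityMeasure μ] [IsMarkovKernel Q]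
    (hfhat : ∀ n a, Measurable (fun q : Hist 𝒳 K n 1 × 𝒳 => fhat n q.1 a q.2))
    (consistent : ∀ a x, TendstoZeroInProb P
      (fun n ω => fhat n ((M n).S ω) a x - fStar Q a x) atTop)
    (bounded_fhat : ∀ n a x, ∀ᵐ ω ∂(P n), |fhat n ((M n).S ω) a x| ≤ C₃) (L : ℝ) :
    TendstoZeroInProb P (fun n ω => L * estimateError μ Q (fhat n ((M n).S ω))) atTop := by
  have hfs := abs_fStar_le_of_consistent M consistent bounded_fhat
  have hm : ∀ n a, Measurable fun p : Ω n × 𝒳 => fhat n ((M n).S p.1) a p.2 - fStar Q a p.2 :=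
    fun n a => ((hfhat n a).comp (((M n).measurable_S.comp measurable_fst).prodMk
      measurable_snd)).sub ((measurable_fStar Q a).comp measurable_snd)
  have hb : ∀ n a x, ∀ᵐ ω ∂(P n), |fhat n ((M n).S ω) a x - fStar Q a x| ≤ C₃ + C₃ := by
    intro n a x
    filter_upwards [bounded_fhat n a x] with ω hω
    exact (abs_sub _ _).trans (add_le_add hω (hfs a x))
  have hint : ∀ n a, Integrable
      (fun p : Ω n × 𝒳 => |fhat n ((M n).S p.1) a p.2 - fStar Q a p.2|) ((P n).prod μ) := by
    intro n a
    refine .of_bound (hm n a).abs.aestronglyMeasurable (C₃ + C₃) ?_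
    have hset : MeasurableSet {p : Ω n × 𝒳 |
        ‖|fhat n ((M n).S p.1) a p.2 - fStar Q a p.2|‖ ≤ C₃ + C₃} :=
      measurableSet_le (hm n a).abs.norm measurable_const
    rw [Measure.ae_prod_iff_ae_ae hset]
    refine (Measure.ae_ae_comm (p := fun x ω =>
      ‖|fhat n ((M n).S ω) a x - fStar Q a x|‖ ≤ C₃ + C₃) (measurable_swap hset)).1
      (ae_of_all _ fun x => ?_)
    simpa only [Real.norm_eq_abs, abs_abs] using hb n a x
  have hinta : ∀ n a, Integrable
      (fun ω => ∫ x, |fhat n ((M n).S ω) a x - fStar Q a x| ∂μ) (P n) :=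
    fun n a => (hint n a).integral_prod_left
  have hlim : ∀ a, Tendsto (fun n => ∫ ω, ∫ x, |fhat n ((M n).S ω) a x - fStar Q a x| ∂μ ∂(P n))
      atTop (𝓝 0) := by
    intro a
    have hswap : ∀ n, ∫ ω, ∫ x, |fhat n ((M n).S ω) a x - fStar Q a x| ∂μ ∂(P n) =
        ∫ x, ∫ ω, |fhat n ((M n).S ω) a x - fStar Q a x| ∂(P n) ∂μ := fun n =>
      integral_integral_swap (hint n a)
    simp only [hswap]
    rw [← integral_zero 𝒳 ℝ (μ := μ)]
    refine tendsto_integral_of_dominated_convergence (fun _ => C₃ + C₃)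
      (fun n => (hint n a).integral_prod_right.aestronglyMeasurable) (integrable_const _)
      (fun n => ae_of_all _ fun x => ?_) (ae_of_all _ fun x => ?_)
    · refine (norm_integral_le_of_norm_le_const (C := C₃ + C₃) ?_).trans (by simp)
      simpa only [Real.norm_eq_abs, abs_abs] using hb n a x
    · exact (consistent a x).tendsto_integral_abs
        (fun n => (hm n a).comp measurable_prodMk_right) fun n => hb n a x
  have hint' : ∀ n, Integrable (fun ω => estimateError μ Q (fhat n ((M n).S ω))) (P n) :=
    fun n => integrable_finsetSum _ fun a _ => hinta n a
  refine tendstoZeroInProb_of_tendsto_integral_abs (fun n => (hint' n).const_mul L) ?_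
  have e : ∀ n, ∫ ω, |L * estimateError μ Q (fhat n ((M n).S ω))| ∂(P n) =
      |L| * ∑ a, ∫ ω, ∫ x, |fhat n ((M n).S ω) a x - fStar Q a x| ∂μ ∂(P n) := by
    intro n
    rw [← integral_finsetSum _ fun a _ => hinta n a, ← integral_const_mul]
    refine integral_congr_ae (ae_of_all _ fun ω => ?_)
    dsimp only
    rw [abs_mul, estimateError, abs_of_nonneg (a := ∑ a, _)
      (Finset.sum_nonneg fun a _ => integral_nonneg fun x => abs_nonneg _)]
  simp only [e]
  simpa using (tendsto_finsetSum Finset.univ fun a _ => hlim a).const_mul |L|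

/-- Convergence in probability of the conditional expectations of `g (Z i)` to the integral of `g`
against random centered normal laws, whose variances converge in probability to `v`, gives
convergence of the expectations. -/
theorem tendsto_integral_of_condExp {ι : Type*} {Ω : ι → Type*} {m : ∀ i, MeasurableSpace (Ω i)}
    [mΩ : ∀ i, MeasurableSpace (Ω i)] (hm : ∀ i, m i ≤ mΩ i) {P : ∀ i, Measure (Ω i)}
    [∀ i, IsProbabilityMeasure (P i)] {l : Filter ι} {Z σ : ∀ i, Ω i → ℝ}
    (hZ : ∀ i, Measurable (Z i)) (g : ℝ →ᵇ ℝ)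
    (h : TendstoZeroInProb P (fun i ω => ((P i)[fun ω' => g (Z i ω') | m i]) ω -
      ∫ z, g z ∂(gaussianReal 0 (σ i ω).toNNReal)) l) {v : NNReal}
    (hσ : TendstoZeroInProb P (fun i ω => σ i ω - v) l) :
    Tendsto (fun i => ∫ ω, g (Z i ω) ∂(P i)) l (𝓝 (∫ z, g z ∂(gaussianReal 0 v))) := by
  set c := ∫ z, g z ∂(gaussianReal 0 v) with hc
  have hcg : |c| ≤ ‖g‖ := by
    rw [← Real.norm_eq_abs]
    exact (norm_integral_le_of_norm_le_const (ae_of_all _ fun z => g.norm_coe_le_norm z)).trans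
      (by simp)
  have hW : TendstoZeroInProb P (fun i ω => ((P i)[fun ω' => g (Z i ω') | m i]) ω - c) l := by
    intro ε hε
    obtain ⟨δ, hδ, hcont⟩ := Metric.continuous_iff.1 (continuous_integral_gaussianReal g) v
      (ε / 2) (half_pos hε)
    have hlim := (h (ε / 2) (half_pos hε)).add (hσ δ hδ)
    rw [add_zero] at hlim
    refine tendsto_of_tendsto_of_tendsto_of_le_of_le tendsto_const_nhds hlim (fun _ => zero_le)
      fun i => (measure_mono fun ω hω => ?_).trans (measure_union_le _ _)
    by_contra hnot
    simp only [Set.mem_union, not_or] at hnot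
    obtain ⟨h1, h2⟩ := hnot
    replace h1 : _ < ε / 2 := not_le.1 (show ¬ (ε / 2 ≤ |_|) from h1)
    replace h2 : _ < δ := not_le.1 (show ¬ (δ ≤ |_|) from h2)
    -- Truncation at zero is 1-Lipschitz, so `toNNReal` does not increase the distance to `v`.
    have h3 := hcont (σ i ω).toNNReal (by
      rw [NNReal.dist_eq, Real.coe_toNNReal']
      refine lt_of_le_of_lt ?_ h2
      have := abs_max_sub_max_le_abs (σ i ω) v 0
      rwa [max_eq_left v.coe_nonneg] at this)
    rw [Real.dist_eq] at h3
    have hω' : ε ≤ |((P i)[fun ω' => g (Z i ω') | m i]) ω - c| := hω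
    have := abs_sub_le (((P i)[fun ω' => g (Z i ω') | m i]) ω)
      (∫ z, g z ∂(gaussianReal 0 (σ i ω).toNNReal)) c
    linarith
  have hgm : ∀ i, Integrable (fun ω => g (Z i ω)) (P i) := fun i =>
    .of_bound (g.continuous.measurable.comp (hZ i)).aestronglyMeasurable ‖g‖
      (ae_of_all _ fun ω => g.norm_coe_le_norm _)
  have habs := hW.tendsto_integral_abs (fun i =>
    ((stronglyMeasurable_condExp.mono (hm i)).measurable).sub_const c) (C := ‖g‖ + ‖g‖) (by
      intro i
      have := ae_bdd_abs_condExp_of_ae_bdd_abs (m := m i) (R := ‖g‖)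
        (μ := P i) (f := fun ω => g (Z i ω)) (ae_of_all _ fun ω => g.norm_coe_le_norm _)
      filter_upwards [this] with ω hω
      exact (abs_sub _ _).trans (add_le_add hω hcg))
  rw [tendsto_iff_norm_sub_tendsto_zero]
  refine squeeze_zero (fun _ => norm_nonneg _) (fun i => ?_) habs
  have e : ∫ ω, g (Z i ω) ∂(P i) - c =
      ∫ ω, (((P i)[fun ω' => g (Z i ω') | m i]) ω - c) ∂(P i) := by
    rw [integral_sub integrable_condExp (integrable_const _), integral_condExp (hm i)]
    simp
  rw [e]
  exact norm_integral_le_integral_norm _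

end sequence

end ITOPE

theorem mainTheorem2
    {𝒳 : Type*} [MeasurableSpace 𝒳] {K : ℕ}
    (μ : Measure 𝒳) [IsProbabilityMeasure μ]
    (Q : Kernel 𝒳 (Fin K → ℝ)) [IsMarkovKernel Q]
    {Ω : ℕ → Type*} [∀ n, MeasurableSpace (Ω n)]
    (P : ∀ n, Measure (Ω n)) [∀ n, IsProbabilityMeasure (P n)]
    (M : ∀ n, ITOPE.Model 𝒳 K μ Q n (Ω n) (P n))
    (πe : ∀ n, Kernel (ITOPE.Hist 𝒳 K n 1 × 𝒳) (Fin K)) [∀ n, IsMarkovKernel (πe n)]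
    (fhat : ∀ n, ITOPE.Hist 𝒳 K n 1 → Fin K → 𝒳 → ℝ)
    (hfhat : ∀ n a, Measurable (fun q : ITOPE.Hist 𝒳 K n 1 × 𝒳 => fhat n q.1 a q.2))
    (C₁ C₂ C₃ : ℝ)
    (overlap : ∀ n a x, ∀ᵐ ω ∂(P n),
      ITOPE.prob (πe n) ((M n).S ω) a x ≤ C₁ * ITOPE.prob (M n).πb ((M n).S ω) a x)
    (bounded_reward : ∀ n (t : ℤ), 1 ≤ t → ∀ᵐ ω ∂(P n), |(M n).Y t ω| ≤ C₂)
    (consistent : ∀ a x, ITOPE.TendstoZeroInProb P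
      (fun n ω => fhat n ((M n).S ω) a x - ITOPE.fStar Q a x) atTop)
    (bounded_fhat : ∀ n a x, ∀ᵐ ω ∂(P n), |fhat n ((M n).S ω) a x| ≤ C₃)
    (t₀ : ℤ) (ht₀ : 1 ≤ t₀) :
    (∀ g : ℝ →ᵇ ℝ, ITOPE.TendstoZeroInProb (fun i : ℕ × ℕ => P i.1)
      (fun i ω =>
        ((P i.1)[fun ω' => g ((M i.1).scaledError (πe i.1) (fhat i.1) t₀ i.2 ω') | (M i.1).sigmaS]) ω
          - ∫ z, g z ∂(gaussianReal 0 ((M i.1).sigmaSq (πe i.1) ω).toNNReal))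
      (atTop ×ˢ atTop)) ∧
    (∀ v : NNReal,
      ITOPE.TendstoZeroInProb P (fun n ω => (M n).sigmaSq (πe n) ω - v) atTop →
      TendstoInDistribution (fun i : ℕ × ℕ => (M i.1).scaledError (πe i.1) (fhat i.1) t₀ i.2)
        (atTop ×ˢ atTop) (id : ℝ → ℝ) (fun i => P i.1) (gaussianReal 0 v)) := by
  have hfs := ITOPE.abs_fStar_le_of_consistent M consistent bounded_fhat
  have hreg := fun n => (M n).ae_regularAt (πe n) (hfhat n) (overlap n)
    (bounded_reward n 1 le_rfl) (bounded_fhat n) hfs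
  have hcond : ∀ g : ℝ →ᵇ ℝ, ITOPE.TendstoZeroInProb (fun i : ℕ × ℕ => P i.1)
      (fun i ω =>
        ((P i.1)[fun ω' => g ((M i.1).scaledError (πe i.1) (fhat i.1) t₀ i.2 ω') | (M i.1).sigmaS]) ω
          - ∫ z, g z ∂(gaussianReal 0 ((M i.1).sigmaSq (πe i.1) ω).toNNReal))
      (atTop ×ˢ atTop) := by
    intro g ε hε
    -- `N` and `δ` are chosen before the pre-period length and the history, which gives the joint
    -- limit.
    obtain ⟨N, δ, hδ, hN⟩ := uniform_centralLimit g (|C₁| * (C₂ + C₃) + C₃ + C₃) hε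
    have hD := (ITOPE.tendstoZeroInProb_estimateError (μ := μ) M hfhat consistent bounded_fhat
      (|C₁| * (2 * C₃)) δ hδ).comp (tendsto_fst (f := atTop) (g := (atTop : Filter ℕ)))
    refine tendsto_of_tendsto_of_tendsto_of_le_of_le' tendsto_const_nhds hD
      (Eventually.of_forall fun _ => zero_le) ?_
    -- The maximum with 1 excludes `T = 0`, where the normalization by `√T` degenerates.
    filter_upwards [tendsto_snd.eventually (eventually_ge_atTop (max N 1))] with i hi
    -- Off a null set, a conditional error of at least `ε` forces the scaled regression error to be
    -- at least `δ`.
    refine measure_mono_ae ?_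
    filter_upwards [(M i.1).condExp_scaledError_ae_eq (πe i.1) (hfhat i.1) (hreg i.1) ht₀
      (lt_of_lt_of_le zero_lt_one ((le_max_right N 1).trans hi)) g,
      ae_of_ae_map (M i.1).measurable_S.aemeasurable (hreg i.1)] with ω hω hr hle
    by_contra hnot
    have hle' : ε ≤ |_| := hle
    rw [hω] at hle'
    exact absurd (hr.abs_integral_sumKernel_sub_lt (hfhat i.1) (abs_nonneg C₁) g
      (hN i.2 ((le_max_left N 1).trans hi)) ((le_abs_self _).trans (not_le.1 hnot).le))
      (not_lt.2 hle')
  refine ⟨hcond, fun v hv => ?_⟩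
  have hmeas : ∀ i : ℕ × ℕ, Measurable ((M i.1).scaledError (πe i.1) (fhat i.1) t₀ i.2) :=
    fun i => (M i.1).measurable_scaledError (πe i.1) (hfhat i.1) t₀ i.2
  refine ⟨fun i => (hmeas i).aemeasurable, aemeasurable_id, ?_⟩
  refine ProbabilityMeasure.tendsto_iff_forall_integral_tendsto.2 fun g => ?_
  have hg : ∀ (m : Measure ℝ), AEStronglyMeasurable g m := fun m =>
    g.continuous.measurable.aestronglyMeasurable
  change Tendsto (fun i : ℕ × ℕ => ∫ z, g z ∂((P i.1).map
    ((M i.1).scaledError (πe i.1) (fhat i.1) t₀ i.2))) _ (𝓝 (∫ z, g z ∂((gaussianReal 0 v).map id)))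
  simp only [Measure.map_id, integral_map (hmeas _).aemeasurable (hg _)]
  exact ITOPE.tendsto_integral_of_condExp (Ω := fun i : ℕ × ℕ => Ω i.1)
    (m := fun i => (M i.1).sigmaS) (fun i => (M i.1).measurable_S.comap_le)
    (σ := fun i => (M i.1).sigmaSq (πe i.1)) hmeas g (hcond g) (v := v)
    (fun ε hε => (hv ε hε).comp tendsto_fst)
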